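/- **Signatures.** Let $\mathsf{Sig}=\mathbf{Set}^{\mathbb N\times\mathbb N}$ be the category of families of sets $\Sigma(n,m)$ ($n,m\in\mathbb N$; "operations of arity $n$ and coarity $m$"). Taking fibres is an equivalence from the category of spans $\mathbb N\leftarrow\Sigma\to\mathbb N$ of sets to $\mathsf{Sig}$. For signatures put $(\Sigma;\Sigma')(n,m)=\coprod_k\Sigma(n,k)\times\Sigma'(k,m)$ and $(\Sigma\otimes\Sigma')(n,m)=\coprod_{a+c=n,\;b+d=m}\Sigma(a,b)\times\Sigma'(c,d)$. Let $\iota,\epsilon,\sigma$ be the constant functors at the signatures with a single operation, of type $(1,1)$, $(0,0)$, $(2,2)$ respectively, and $$S_{SM}=(\mathrm{Id};\mathrm{Id})+\iota+(\mathrm{Id}\otimes\mathrm{Id})+\epsilon+\sigma\colon\mathsf{Sig}\to\mathsf{Sig}.$$ Let $S_{SM}^\dagger$ be the monad of terms over these operations. **Quotients of monads.** Equations for a monad $T$ on $\mathsf{Sig}$ are a triple $E=(A,l,r)$ of a functor $A\colon\mathsf{Sig}\to\mathsf{Sig}$ and natural transformations $l,r\colon A\Rightarrow T$. A quotient of $T$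 by $E$ is a monad $T/E$ with a monad morphism $q\colon T\to T/E$ with epi components, such that a $T$-algebra $\alpha\colon TX\to X$ is the restriction along $q$ of a $T/E$-algebra if and only if $\alpha\circ l_X=\alpha\circ r_X$. A quotient is obtained by dividing each free algebra $TX$ by the congruence generated by the instances of the equations; the monads $S_{PROP}$ and $S_{CW}$ below are defined in this way. **The prop monad.** In $S_{SM}^\dagger$ write $id_0=\epsilon$, $id_{n+1}=id_n\otimes id_1$; $\sigma_{1,0}=\sigma_{0,1}=id_1$, $\sigma_{1,n+1}=(\sigma_{1,n}\otimes id_1);(id_n\otimes\sigma)$, $\sigma_{n+1,1}=(id_n\otimes\sigma);(\sigma_{n,1}\otimes id_1)$. Let $E_{SM}$ consist of the equations, for all $f,g,h,i$ of the appropriate types, $$(f\otimes g)\otimes h\equiv f\otimes(g\otimes h),\quad \epsilon\otimes f\equiv f,\quad f\otimes\epsilon\equiv f,\quad \sigma;\sigma\equiv id_2,\quad (f;g)\otimes(h;i)\equiv(f\otimes h);(g\otimes i),$$ $$(f;g);h\equiv f;(g;h),\quad f;id_m\equiv f,\quad id_n;f\equiv f,$$ $$\sigma_{1,n};(f\otimes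 id_1)\equiv(id_1\otimes f);\sigma_{1,m},\quad \sigma_{n,1};(id_1\otimes g)\equiv(g\otimes id_1);\sigma_{m,1}\qquad(f,g\text{ of type }(n,m)).$$ Let $S_{PROP}$ be the quotient of $S_{SM}^\dagger$ by $E_{SM}$. Let $\mathsf{PROP}$ be the category of props, i.e. symmetric strict monoidal categories with set of objects $\mathbb N$, tensor unit $0$, and tensor product of objects $n\otimes m=n+m$, with identity-on-objects strict symmetric monoidal functors. **The Carboni–Walters monad.** Let $K$ be the signature with four operations $\delta,\varepsilon,\mu,\eta$ of types $(1,2),(1,0),(2,1),(0,1)$; let $S_{FR}$ be the monad $X\mapsto S_{PROP}(X+K)$, and let $S_{CW}$ be the quotient of $S_{FR}$ by the equations of special Frobenius bimonoids $$\delta;(\delta\otimes id_1)\equiv\delta;(id_1\otimes\delta),\quad \delta;\sigma\equiv\delta,\quad \delta;(\varepsilon\otimes id_1)\equiv id_1,\quad (\mu\otimes id_1);\mu\equiv(id_1\otimes\mu);\mu,\quad \sigma;\mu\equiv\mu,\quad (\eta\otimes id_1);\mu\equiv id_1,$$ $$\delta;\mu\equiv id_1,\quad (\delta\otimes id_1);(id_1\otimes\mu)\equiv\mu;\delta\equiv(id_1\otimes\delta);(\mu\otimes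 id_1).$$ Let $\mathsf{CWP}$ be the category of props equipped with arrows $\delta\colon1\to2$, $\varepsilon\colon1\to0$, $\mu\colon2\to1$, $\eta\colon0\to1$ which satisfy these equations, with the prop morphisms that preserve these four arrows. **Claim.** 1. $S_{SM}^\dagger$ is the free monad on $S_{SM}$: with its unit and the formation of terms, $S_{SM}^\dagger X$ is an initial $(X+S_{SM})$-algebra for each $X$, and the multiplication is a morphism of $S_{SM}$-algebras. Moreover $S_{PROP}$ is a quotient of $S_{SM}^\dagger$ by $E_{SM}$ in the above sense. 2. There is an isomorphism of categories $EM(S_{PROP})\cong\mathsf{PROP}$ between the Eilenberg–Moore category of $S_{PROP}$ and $\mathsf{PROP}$. It preserves the underlying signature and the operations: the composition, the identity on $1$, the monoidal product, the identity on $0$ and the symmetry $1+1\to1+1$ of the prop are the operations of the algebra. 3. $S_{FR}$ is the coproduct, in the category of monads on $\mathsf{Sig}$, of $S_{PROP}$ and the free monad on the constant functor at $K$; $S_{CW}$ is a quotient of $S_{FR}$ by the special Frobenius equations in the above sense; and there is an isomorphism of categories $EM(S_{CW})\cong\mathsf{CWP}$, which likewise preserves the underlying signature, the prop operations and $\delta,\varepsilon,\mu,\eta$.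 -/

import Mathlib

open CategoryTheory MonoidalCategory

universe u

namespace StringDiag

/-! ## Signatures -/

/-- Signatures as families of sets indexed by pairs (arity, coarity): the category
of families of sets indexed by the discrete category on pairs of natural numbers. -/
def Sig : Type (u + 1) := ℕ → ℕ → Type u

instance : Category.{u} Sig.{u} where
  Hom X Y := ∀ n m : ℕ, X n m → Y n m
  id _ := fun _ _ x => x
  comp f g := fun n m x => g n m (f n m x)

theorem Sig.hom_ext {X Y : Sig.{u}} {f g : X ⟶ Y} (h : ∀ n m x, f n m x = g n m x) : f = g :=
  funext fun n => funext fun m => funext fun x => h n m x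

/-- Signatures as spans `ℕ ← Σ → ℕ` in the category of sets. -/
structure SpanSig : Type (u + 1) where
  carrier : Type u
  ar : carrier → ℕ
  coar : carrier → ℕ

/-- Morphisms of spans. -/
@[ext]
structure SpanSig.Mor (X Y : SpanSig.{u}) : Type u where
  fn : X.carrier → Y.carrier
  ar_fn : ∀ x, Y.ar (fn x) = X.ar x
  coar_fn : ∀ x, Y.coar (fn x) = X.coar x

instance : Category.{u} SpanSig.{u} where
  Hom X Y := SpanSig.Mor X Y
  id X := ⟨fun x => x, fun _ => rfl, fun _ => rfl⟩
  comp f g := ⟨fun x => g.fn (f.fn x), fun x => (g.ar_fn _).trans (f.ar_fn x),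
    fun x => (g.coar_fn _).trans (f.coar_fn x)⟩

/-- The comparison functor: a span is sent to the family of its fibres `Σ(n, m)`. -/
def fibres : SpanSig.{u} ⥤ Sig.{u} where
  obj X := fun n m => {x : X.carrier // X.ar x = n ∧ X.coar x = m}
  map f := fun _ _ x =>
    ⟨f.fn x.1, (f.ar_fn x.1).trans x.2.1, (f.coar_fn x.1).trans x.2.2⟩

/-- Transport of an operation along equalities of its arity and coarity. In the span
presentation this is the identity on the underlying set of operations. -/
def Sig.recast {X : Sig.{u}} {n m n' m' : ℕ} (hn : n = n') (hm : m = m') (x : X n m) : X n' m' :=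
  hm ▸ hn ▸ x

theorem Sig.recast_map {X Y : Sig.{u}} (f : X ⟶ Y) {n m n' m' : ℕ} (hn : n = n') (hm : m = m')
    (x : X n m) : f n' m' (Sig.recast hn hm x) = Sig.recast hn hm (f n m x) := by
  subst hn; subst hm; rfl

/-! ## Functors on signatures -/

/-- Sequential composition of signatures: pairs of composable operations. -/
inductive Seq (X Y : Sig.{u}) : ℕ → ℕ → Type u
  | mk {n k m : ℕ} (f : X n k) (g : Y k m) : Seq X Y n m

/-- Parallel composition of signatures: pairs of operations, with arities and coarities added. -/
inductive Par (X Y : Sig.{u}) : ℕ → ℕ → Type u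
  | mk {a b c d : ℕ} (f : X a b) (g : Y c d) : Par X Y (a + c) (b + d)

/-- The signature with a single operation, of arity `a` and coarity `b`. -/
inductive Pt (a b : ℕ) : ℕ → ℕ → Type u
  | pt : Pt a b a b

/-- The signature with arity and coarity of every operation of `X` raised by one. -/
inductive PlusOne (X : Sig.{u}) : ℕ → ℕ → Type u
  | mk {n m : ℕ} (f : X n m) : PlusOne X (n + 1) (m + 1)

/-- Coproduct of signatures. -/
def Sig.sum (X Y : Sig.{u}) : Sig.{u} := fun n m => X n m ⊕ Y n m

def Sig.inl {X Y : Sig.{u}} : X ⟶ Sig.sum X Y := fun _ _ x => Sum.inl x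

def Sig.inr {X Y : Sig.{u}} : Y ⟶ Sig.sum X Y := fun _ _ y => Sum.inr y

def Sig.desc {X Y Z : Sig.{u}} (f : X ⟶ Z) (g : Y ⟶ Z) : Sig.sum X Y ⟶ Z :=
  fun n m x => Sum.elim (f n m) (g n m) x

theorem Sig.inl_desc {X Y Z W : Sig.{u}} (f : X ⟶ Z) (g : Y ⟶ Z) (h : Z ⟶ W) :
    Sig.inl ≫ Sig.desc f g ≫ h = f ≫ h :=
  rfl

theorem Sig.inr_desc {X Y Z W : Sig.{u}} (f : X ⟶ Z) (g : Y ⟶ Z) (h : Z ⟶ W) :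
    Sig.inr ≫ Sig.desc f g ≫ h = g ≫ h :=
  rfl

theorem Sig.sum_ext {X Y Z : Sig.{u}} {f g : Sig.sum X Y ⟶ Z} (hl : Sig.inl ≫ f = Sig.inl ≫ g)
    (hr : Sig.inr ≫ f = Sig.inr ≫ g) : f = g :=
  Sig.hom_ext fun n m x => by
    rcases x with x | x
    · exact congrFun (congrFun (congrFun hl n) m) x
    · exact congrFun (congrFun (congrFun hr n) m) x

def seqDesc {X Y Z : Sig.{u}} (op : ∀ {n k m : ℕ}, X n k → Y k m → Z n m) :
    (show Sig.{u} from Seq X Y) ⟶ Z :=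
  fun _ _ x => match x with
    | .mk f g => op f g

def parDesc {X Y Z : Sig.{u}} (op : ∀ {a b c d : ℕ}, X a b → Y c d → Z (a + c) (b + d)) :
    (show Sig.{u} from Par X Y) ⟶ Z :=
  fun _ _ x => match x with
    | .mk f g => op f g

def ptDesc {a b : ℕ} {Z : Sig.{u}} (z : Z a b) : (show Sig.{u} from Pt a b) ⟶ Z :=
  fun _ _ x => match x with
    | .pt => z

def plusOneDesc {X Z : Sig.{u}} (op : ∀ {n m : ℕ}, X n m → Z (n + 1) (m + 1)) :
    (show Sig.{u} from PlusOne X) ⟶ Z :=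
  fun _ _ x => match x with
    | .mk f => op f

/-- The identity functor on signatures. -/
abbrev Id : Sig.{u} ⥤ Sig.{u} := 𝟭 Sig.{u}

/-- The functor constant at `K`. -/
def constF (K : Sig.{u}) : Sig.{u} ⥤ Sig.{u} where
  obj _ := K
  map _ := 𝟙 K

def seqF (F G : Sig.{u} ⥤ Sig.{u}) : Sig.{u} ⥤ Sig.{u} where
  obj X := Seq (F.obj X) (G.obj X)
  map f := seqDesc fun x y => .mk (F.map f _ _ x) (G.map f _ _ y)
  map_id X := Sig.hom_ext fun n m x => by
    cases x; simp only [seqDesc, CategoryTheory.Functor.map_id]; rfl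
  map_comp f g := Sig.hom_ext fun n m x => by
    cases x; simp only [seqDesc, Functor.map_comp]; rfl

def parF (F G : Sig.{u} ⥤ Sig.{u}) : Sig.{u} ⥤ Sig.{u} where
  obj X := Par (F.obj X) (G.obj X)
  map f := parDesc fun x y => .mk (F.map f _ _ x) (G.map f _ _ y)
  map_id X := Sig.hom_ext fun n m x => by
    cases x; simp only [parDesc, CategoryTheory.Functor.map_id]; rfl
  map_comp f g := Sig.hom_ext fun n m x => by
    cases x; simp only [parDesc, Functor.map_comp]; rfl

def sumF (F G : Sig.{u} ⥤ Sig.{u}) : Sig.{u} ⥤ Sig.{u} where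
  obj X := Sig.sum (F.obj X) (G.obj X)
  map f := Sig.desc (F.map f ≫ Sig.inl) (G.map f ≫ Sig.inr)
  map_id X := Sig.hom_ext fun n m x => by
    cases x <;> simp only [Sig.desc, CategoryTheory.Functor.map_id] <;> rfl
  map_comp f g := Sig.hom_ext fun n m x => by
    cases x <;> simp only [Sig.desc, Functor.map_comp] <;> rfl

def plusOneF (F : Sig.{u} ⥤ Sig.{u}) : Sig.{u} ⥤ Sig.{u} where
  obj X := PlusOne (F.obj X)
  map f := plusOneDesc fun x => .mk (F.map f _ _ x)
  map_id X := Sig.hom_ext fun n m x => by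
    cases x; simp only [plusOneDesc, CategoryTheory.Functor.map_id]; rfl
  map_comp f g := Sig.hom_ext fun n m x => by
    cases x; simp only [plusOneDesc, Functor.map_comp]; rfl

/-- The identity on the object `1`. -/
def iotaF : Sig.{u} ⥤ Sig.{u} := constF (Pt 1 1)

/-- The unit of the monoidal product. -/
def epsF : Sig.{u} ⥤ Sig.{u} := constF (Pt 0 0)

/-- The basic symmetry. -/
def sigmaF : Sig.{u} ⥤ Sig.{u} := constF (Pt 2 2)

/-- The signature functor of the operations of props. -/
def SSM : Sig.{u} ⥤ Sig.{u} :=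
  sumF (seqF Id Id) (sumF iotaF (sumF (parF Id Id) (sumF epsF sigmaF)))

/-- The map out of `SSM X` given by an interpretation of each of the five operations. -/
def SSM.desc {X Y : Sig.{u}} (comp : ∀ {n k m : ℕ}, X n k → X k m → Y n m) (one : Y 1 1)
    (tens : ∀ {a b c d : ℕ}, X a b → X c d → Y (a + c) (b + d)) (unit : Y 0 0) (sw : Y 2 2) :
    SSM.obj X ⟶ Y :=
  Sig.desc (seqDesc comp) (Sig.desc (ptDesc one)
    (Sig.desc (parDesc tens) (Sig.desc (ptDesc unit) (ptDesc sw))))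

/-! ## Free monads, equations and quotients of monads -/

/-- `T`, with the structure maps `κ`, is the free monad on the endofunctor `F`: the maps
`[η, κ] : X + F (T X) → T X` make `T X` an initial `(X + F)`-algebra, and the multiplication
is the algebra morphism which is the identity on `T X`. -/
structure IsFreeMonad (F : Sig.{u} ⥤ Sig.{u}) (T : Monad Sig.{u})
    (κ : T.toFunctor ⋙ F ⟶ T.toFunctor) : Prop where
  initial : ∀ X : Sig.{u}, Nonempty (Limits.IsInitial
    (⟨T.obj X, Sig.desc (T.η.app X) (κ.app X)⟩ : Endofunctor.Algebra (sumF (constF X) F)))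
  mul : ∀ X : Sig.{u}, κ.app (T.obj X) ≫ T.μ.app X = F.map (T.μ.app X) ≫ κ.app X

/-- Equations for a monad `T`: a functor of variables and two natural transformations
into `T`, the left- and right-hand sides. -/
structure MonadEqs (T : Monad Sig.{u}) where
  A : Sig.{u} ⥤ Sig.{u}
  l : A ⟶ T.toFunctor
  r : A ⟶ T.toFunctor

/-- An algebra satisfies the equations. -/
def MonadEqs.Sat {T : Monad Sig.{u}} (E : MonadEqs T) (B : T.Algebra) : Prop :=
  E.l.app B.A ≫ B.a = E.r.app B.A ≫ B.a

/-- `Q` with `q` is the quotient of the monad `T` by the equations `E`: the monad morphism `q`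
has epi components, and the `Q`-algebras are, by restriction along `q`, precisely the
`T`-algebras which satisfy `E`. -/
structure IsQuotientMonad {T : Monad Sig.{u}} (E : MonadEqs T) (Q : Monad Sig.{u})
    (q : T ⟶ Q) : Prop where
  epi : ∀ X : Sig.{u}, Epi (q.app X)
  algebras : ∀ B : T.Algebra,
    E.Sat B ↔ ∃ B' : Q.Algebra, (Monad.algebraFunctorOfMonadHom q).obj B' = B

/-- The union of two families of equations. -/
def MonadEqs.union {T : Monad Sig.{u}} (E E' : MonadEqs T) : MonadEqs T where
  A := sumF E.A E'.A
  l :=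
    { app := fun X => Sig.desc (E.l.app X) (E'.l.app X)
      naturality := fun X Y f => Sig.hom_ext fun n m x => by
        rcases x with x | x
        · exact congrFun (congrFun (congrFun (E.l.naturality f) n) m) x
        · exact congrFun (congrFun (congrFun (E'.l.naturality f) n) m) x }
  r :=
    { app := fun X => Sig.desc (E.r.app X) (E'.r.app X)
      naturality := fun X Y f => Sig.hom_ext fun n m x => by
        rcases x with x | x
        · exact congrFun (congrFun (congrFun (E.r.naturality f) n) m) x
        · exact congrFun (congrFun (congrFun (E'.r.naturality f) n) m) x }

namespace MonadEqs

variable {T : Monad Sig.{u}} (E : MonadEqs T)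

/-- The map `h` is an algebra homomorphism from the free algebra on `X` to `B` which
identifies the two sides of every instance of the equations in that free algebra. -/
structure Respects {X : Sig.{u}} (B : T.Algebra) (h : T.obj X ⟶ B.A) : Prop where
  hom : T.map h ≫ B.a = T.μ.app X ≫ h
  eqs : E.l.app (T.obj X) ≫ T.μ.app X ≫ h = E.r.app (T.obj X) ≫ T.μ.app X ≫ h

/-- The congruence generated by the equations on the free algebra `T X`: the intersection
of the kernels of all algebra homomorphisms which respect the equations. -/
def congr (X : Sig.{u}) (n m : ℕ) : Setoid (T.obj X n m) where
  r t t' := ∀ (B : T.Algebra) (h : T.obj X ⟶ B.A), E.Respects B h → h n m t = h n m t'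
  iseqv :=
    { refl := fun _ _ _ _ => rfl
      symm := fun H B h hh => (H B h hh).symm
      trans := fun H H' B h hh => (H B h hh).trans (H' B h hh) }

/-- The quotient of `T X` by the generated congruence. -/
def quotObj (X : Sig.{u}) : Sig.{u} := fun n m => Quotient (E.congr X n m)

/-- The projection onto the quotient. -/
def proj (X : Sig.{u}) : T.obj X ⟶ E.quotObj X := fun n m t => Quotient.mk (E.congr X n m) t

/-- A section of the projection. -/
noncomputable def sec (X : Sig.{u}) : E.quotObj X ⟶ T.obj X := fun _ _ t => t.out

theorem sec_proj (X : Sig.{u}) : E.sec X ≫ E.proj X = 𝟙 _ :=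
  Sig.hom_ext fun _ _ t => t.out_eq

/-- A map out of `T X` compatible with the congruence descends to the quotient. -/
def lift {X Y : Sig.{u}} (f : T.obj X ⟶ Y)
    (hf : ∀ n m t t', E.congr X n m t t' → f n m t = f n m t') : E.quotObj X ⟶ Y :=
  fun n m => Quotient.lift (f n m) (hf n m)

theorem proj_lift {X Y : Sig.{u}} (f : T.obj X ⟶ Y)
    (hf : ∀ n m t t', E.congr X n m t t' → f n m t = f n m t') : E.proj X ≫ E.lift f hf = f :=
  rfl

theorem proj_cancel {X Y : Sig.{u}} {f g : E.quotObj X ⟶ Y} (h : E.proj X ≫ f = E.proj X ≫ g) :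
    f = g :=
  Sig.hom_ext fun n m t => by
    induction t using Quotient.inductionOn with
    | h t => exact congrFun (congrFun (congrFun h n) m) t

theorem map_proj_cancel {X Y : Sig.{u}} {f g : T.obj (E.quotObj X) ⟶ Y}
    (h : T.map (E.proj X) ≫ f = T.map (E.proj X) ≫ g) : f = g := by
  have := congrArg (fun k => T.map (E.sec X) ≫ k) h
  simpa only [← Category.assoc, ← Functor.map_comp, sec_proj, CategoryTheory.Functor.map_id,
    Category.id_comp] using this

theorem map_map_proj_cancel {X Y : Sig.{u}} {f g : T.obj (T.obj (E.quotObj X)) ⟶ Y}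
    (h : T.map (T.map (E.proj X)) ≫ f = T.map (T.map (E.proj X)) ≫ g) : f = g := by
  have := congrArg (fun k => T.map (T.map (E.sec X)) ≫ k) h
  simpa only [← Category.assoc, ← Functor.map_comp, sec_proj, CategoryTheory.Functor.map_id,
    Category.id_comp] using this

/-- Homomorphisms which respect the equations do not see the choice of representatives. -/
theorem proj_sec_hom {X : Sig.{u}} {B : T.Algebra} (h : T.obj X ⟶ B.A) (hh : E.Respects B h) :
    E.proj X ≫ E.sec X ≫ h = h :=
  Sig.hom_ext fun n m t => (Quotient.mk_out (s := E.congr X n m) t) B h hh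

theorem respects_map {X Y : Sig.{u}} (f : X ⟶ Y) {B : T.Algebra} (h : T.obj Y ⟶ B.A)
    (hh : E.Respects B h) : E.Respects B (T.map f ≫ h) where
  hom := by
    rw [T.map_comp_assoc, hh.hom, Monad.mu_naturality_assoc]
  eqs := by
    have hl := E.l.naturality_assoc (T.map f) (T.μ.app Y ≫ h)
    have hr := E.r.naturality_assoc (T.map f) (T.μ.app Y ≫ h)
    rw [← Monad.mu_naturality_assoc, ← hl, ← hr, hh.eqs]

def quotMap {X Y : Sig.{u}} (f : X ⟶ Y) : E.quotObj X ⟶ E.quotObj Y :=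
  E.lift (T.map f ≫ E.proj Y) fun n m t t' H =>
    Quotient.sound fun B h hh => H B (T.map f ≫ h) (E.respects_map f h hh)

theorem proj_quotMap {X Y : Sig.{u}} (f : X ⟶ Y) :
    E.proj X ≫ E.quotMap f = T.map f ≫ E.proj Y :=
  rfl

/-- The algebra structure on the quotient of the free algebra. -/
noncomputable def quotStr (X : Sig.{u}) : T.obj (E.quotObj X) ⟶ E.quotObj X :=
  T.map (E.sec X) ≫ T.μ.app X ≫ E.proj X

theorem map_proj_quotStr (X : Sig.{u}) :
    T.map (E.proj X) ≫ E.quotStr X = T.μ.app X ≫ E.proj X := by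
  refine Sig.hom_ext fun n m y => Quotient.sound fun B h hh => ?_
  have : T.map (E.proj X) ≫ T.map (E.sec X) ≫ T.μ.app X ≫ h = T.μ.app X ≫ h := by
    rw [← hh.hom, ← T.map_comp_assoc, ← T.map_comp_assoc, Category.assoc, E.proj_sec_hom h hh]
  exact congrFun (congrFun (congrFun this n) m) y

/-- The quotient of the free algebra, as an algebra. -/
noncomputable def quotAlg (X : Sig.{u}) : T.Algebra where
  A := E.quotObj X
  a := E.quotStr X
  unit := by
    apply E.proj_cancel
    rw [T.unit_naturality_assoc, E.map_proj_quotStr, T.left_unit_assoc, Category.comp_id]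
  assoc := by
    apply E.map_map_proj_cancel
    rw [T.mu_naturality_assoc, E.map_proj_quotStr, ← T.map_comp_assoc,
      E.map_proj_quotStr, T.map_comp_assoc, E.map_proj_quotStr, ← Category.assoc, ← Category.assoc,
      T.assoc]

theorem quotAlg_sat (X : Sig.{u}) : E.Sat (E.quotAlg X) := by
  have key : ∀ k : E.A ⟶ T.toFunctor, E.A.map (E.proj X) ≫ k.app (E.quotObj X) ≫ E.quotStr X =
      k.app (T.obj X) ≫ T.μ.app X ≫ E.proj X := fun k => by
    rw [k.naturality_assoc, E.map_proj_quotStr]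
  have hlr : E.l.app (T.obj X) ≫ T.μ.app X ≫ E.proj X =
      E.r.app (T.obj X) ≫ T.μ.app X ≫ E.proj X :=
    Sig.hom_ext fun n m e => Quotient.sound fun B h hh => congrFun (congrFun (congrFun hh.eqs n) m) e
  have := congrArg (fun k => E.A.map (E.sec X) ≫ k) ((key E.l).trans (hlr.trans (key E.r).symm))
  simp only [← E.A.map_comp_assoc, sec_proj, CategoryTheory.Functor.map_id,
    Category.id_comp] at this
  exact this

theorem quotStr_respects (X : Sig.{u}) : E.Respects (E.quotAlg X) (E.quotStr X) where
  hom := (E.quotAlg X).assoc.symm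
  eqs := by
    have h : T.μ.app (E.quotObj X) ≫ E.quotStr X = T.map (E.quotStr X) ≫ E.quotStr X :=
      (E.quotAlg X).assoc
    have hs : E.l.app (E.quotObj X) ≫ E.quotStr X = E.r.app (E.quotObj X) ≫ E.quotStr X :=
      E.quotAlg_sat X
    have hl := E.l.naturality_assoc (E.quotStr X) (E.quotStr X)
    have hr := E.r.naturality_assoc (E.quotStr X) (E.quotStr X)
    exact (congrArg (fun k => E.l.app _ ≫ k) h).trans (hl.symm.trans
      ((congrArg (fun k => E.A.map _ ≫ k) hs).trans
        (hr.trans (congrArg (fun k => E.r.app _ ≫ k) h.symm))))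

/-- The multiplication of the quotient monad. -/
noncomputable def quotMul (X : Sig.{u}) : E.quotObj (E.quotObj X) ⟶ E.quotObj X :=
  E.lift (E.quotStr X) fun _ _ _ _ H => H (E.quotAlg X) (E.quotStr X) (E.quotStr_respects X)

theorem proj_quotMul (X : Sig.{u}) : E.proj (E.quotObj X) ≫ E.quotMul X = E.quotStr X :=
  rfl

/-- The quotient of the monad `T` by the equations `E`. -/
noncomputable def quotient : Monad Sig.{u} where
  obj := E.quotObj
  map := E.quotMap
  map_id X := E.proj_cancel (by
    rw [E.proj_quotMap, T.map_id, Category.id_comp, Category.comp_id])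
  map_comp f g := E.proj_cancel (by
    rw [E.proj_quotMap, T.map_comp, Category.assoc, ← E.proj_quotMap, ← Category.assoc,
      ← E.proj_quotMap, Category.assoc])
  η :=
    { app := fun X => T.η.app X ≫ E.proj X
      naturality := fun X Y f => by
        rw [Category.assoc, E.proj_quotMap]
        exact T.unit_naturality_assoc _ f (E.proj Y) }
  μ :=
    { app := E.quotMul
      naturality := fun X Y f => by
        apply E.proj_cancel
        apply E.map_proj_cancel
        change T.map (E.proj X) ≫ T.map (E.quotMap f) ≫ E.quotStr Y =
          (T.map (E.proj X) ≫ E.quotStr X) ≫ E.quotMap f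
        rw [E.map_proj_quotStr, Category.assoc, E.proj_quotMap, ← T.map_comp_assoc, E.proj_quotMap,
          T.map_comp_assoc, E.map_proj_quotStr, T.mu_naturality_assoc] }
  assoc X := by
    apply E.proj_cancel
    apply E.map_proj_cancel
    change T.map (E.proj _) ≫ T.map (E.quotMul X) ≫ E.quotStr X =
      (T.map (E.proj _) ≫ E.quotStr _) ≫ E.quotMul X
    rw [E.map_proj_quotStr, Category.assoc, E.proj_quotMul, ← T.map_comp_assoc, E.proj_quotMul]
    exact (E.quotAlg X).assoc.symm
  left_unit X := by
    change T.η.app _ ≫ E.quotStr X = _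
    exact (E.quotAlg X).unit
  right_unit X := by
    apply E.proj_cancel
    change T.map (T.η.app X ≫ E.proj X) ≫ E.quotStr X = E.proj X
    rw [T.map_comp_assoc, E.map_proj_quotStr, ← Category.assoc, T.right_unit, Category.id_comp]

/-- The projection onto the quotient monad. -/
noncomputable def quotientProj : T ⟶ E.quotient where
  app X := E.proj X
  naturality X Y f := (E.proj_quotMap f).symm
  app_η _ := rfl
  app_μ X := by
    change _ = (T.map (E.proj X) ≫ E.proj (E.quotObj X)) ≫ E.quotMul X
    rw [Category.assoc, E.proj_quotMul, E.map_proj_quotStr]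
    rfl

end MonadEqs

/-! ## The prop monad -/

/-- Terms over the signature `X` built from the operations of props. -/
inductive SMTerm (X : Sig.{u}) : ℕ → ℕ → Type u
  | var {n m : ℕ} (x : X n m) : SMTerm X n m
  | comp {n k m : ℕ} (f : SMTerm X n k) (g : SMTerm X k m) : SMTerm X n m
  | one : SMTerm X 1 1
  | tens {a b c d : ℕ} (f : SMTerm X a b) (g : SMTerm X c d) : SMTerm X (a + c) (b + d)
  | unit : SMTerm X 0 0
  | sw : SMTerm X 2 2

namespace SMTerm

variable {X Y Z : Sig.{u}}

/-- Simultaneous substitution of terms for the variables of a term. -/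
def bind (f : ∀ n m : ℕ, X n m → SMTerm Y n m) : ∀ {n m : ℕ}, SMTerm X n m → SMTerm Y n m
  | _, _, var x => f _ _ x
  | _, _, comp s t => comp (bind f s) (bind f t)
  | _, _, one => one
  | _, _, tens s t => tens (bind f s) (bind f t)
  | _, _, unit => unit
  | _, _, sw => sw

theorem bind_var {n m : ℕ} (t : SMTerm X n m) : bind (fun _ _ x => var x) t = t := by
  induction t <;> simp_all only [bind]

theorem bind_bind (f : ∀ n m : ℕ, X n m → SMTerm Y n m) (g : ∀ n m : ℕ, Y n m → SMTerm Z n m)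
    {n m : ℕ} (t : SMTerm X n m) :
    bind g (bind f t) = bind (fun _ _ x => bind g (f _ _ x)) t := by
  induction t <;> simp_all only [bind]

theorem bind_recast (φ : X ⟶ Y) {n m n' m' : ℕ} (hn : n = n') (hm : m = m') (t : SMTerm X n m) :
    bind (Y := Y) (fun _ _ x => var (φ _ _ x)) (Sig.recast (X := SMTerm X) hn hm t) =
      Sig.recast (X := SMTerm Y) hn hm (bind (Y := Y) (fun _ _ x => var (φ _ _ x)) t) := by
  subst hn; subst hm; rfl

/-- The identity on `n`: the parallel composition of `n` copies of the identity on `1`. -/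
def idn : ∀ n : ℕ, SMTerm X n n
  | 0 => unit
  | n + 1 => tens (idn n) one

/-- The symmetry of `1` past `n`. -/
def sigL : ∀ n : ℕ, SMTerm X (1 + n) (n + 1)
  | 0 => one
  | n + 1 =>
      comp (n := 1 + n + 1) (k := n + 1 + 1) (m := n + 2)
        (tens (sigL n) one) (tens (a := n) (b := n) (c := 2) (d := 2) (idn n) sw)

/-- The symmetry of `n` past `1`. -/
def sigR : ∀ n : ℕ, SMTerm X (n + 1) (1 + n)
  | 0 => one
  | n + 1 =>
      comp (n := n + 2) (k := n + 1 + 1) (m := 1 + n + 1)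
        (tens (a := n) (b := n) (c := 2) (d := 2) (idn n) sw) (tens (sigR n) one)

theorem bind_idn (f : ∀ n m : ℕ, X n m → SMTerm Y n m) (n : ℕ) : bind f (idn n) = idn n := by
  induction n <;> simp_all only [bind, idn]

theorem bind_sigL (f : ∀ n m : ℕ, X n m → SMTerm Y n m) (n : ℕ) : bind f (sigL n) = sigL n := by
  induction n <;> simp_all only [bind, sigL, bind_idn]

theorem bind_sigR (f : ∀ n m : ℕ, X n m → SMTerm Y n m) (n : ℕ) : bind f (sigR n) = sigR n := by
  induction n <;> simp_all only [bind, sigR, bind_idn]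

end SMTerm

/-- The term monad. -/
def SSMFree : Monad Sig.{u} where
  obj X := SMTerm X
  map f := fun _ _ t => t.bind fun _ _ x => .var (f _ _ x)
  map_id X := Sig.hom_ext fun n m t => SMTerm.bind_var t
  map_comp f g := Sig.hom_ext fun n m t => by
    exact (SMTerm.bind_bind (fun _ _ x => .var (f _ _ x)) (fun _ _ x => .var (g _ _ x)) t).symm
  η := { app := fun _ _ _ x => .var x }
  μ :=
    { app := fun _ _ _ t => t.bind fun _ _ s => s
      naturality := fun X Y f => Sig.hom_ext fun n m t => by
        exact (SMTerm.bind_bind (X := SMTerm X) (Z := Y) _ _ t).trans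
          (SMTerm.bind_bind (X := SMTerm X) (Y := X) (Z := Y) (fun _ _ s => s)
            (fun _ _ x => .var (f _ _ x)) t).symm }
  assoc X := Sig.hom_ext fun n m t => by
    exact (SMTerm.bind_bind (X := SMTerm (SMTerm X)) (Z := X) _ _ t).trans
      (SMTerm.bind_bind (X := SMTerm (SMTerm X)) (Y := SMTerm X) (Z := X) (fun _ _ s => s)
        (fun _ _ s => s) t).symm
  left_unit X := rfl
  right_unit X := Sig.hom_ext fun n m t => by
    exact (SMTerm.bind_bind (X := X) (Z := X) _ _ t).trans (SMTerm.bind_var t)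

/-- The formation of terms from an operation applied to terms. -/
def SSMFree.op : SSMFree.{u}.toFunctor ⋙ SSM ⟶ SSMFree.{u}.toFunctor where
  app _ := SSM.desc SMTerm.comp SMTerm.one SMTerm.tens SMTerm.unit SMTerm.sw
  naturality X Y f := Sig.hom_ext fun n m t => by
    rcases t with ⟨⟨⟩⟩ | ⟨⟨⟩⟩ | ⟨⟨⟩⟩ | ⟨⟨⟩⟩ | ⟨⟨⟩⟩ <;> rfl

/-- The operations of props, applied to variables. -/
def SSMFree.incl : SSM.{u} ⟶ SSMFree.{u}.toFunctor where
  app X := SSM.map (SSMFree.η.app X) ≫ SSMFree.op.app X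
  naturality X Y f := Sig.hom_ext fun n m t => by
    rcases t with ⟨⟨⟩⟩ | ⟨⟨⟩⟩ | ⟨⟨⟩⟩ | ⟨⟨⟩⟩ | ⟨⟨⟩⟩ <;> rfl

namespace SMEq

open SMTerm

/-- `(f ⊗ g) ⊗ h ≡ f ⊗ (g ⊗ h)` -/
def tensAssoc : MonadEqs SSMFree.{u} where
  A := parF (parF Id Id) Id
  l :=
    { app := fun X _ _ x => match x with
        | .mk (.mk f g) h => tens (tens (var f) (var g)) (var h)
      naturality := fun X Y φ => Sig.hom_ext fun n m x => by
        rcases x with ⟨⟨f, g⟩, h⟩; rfl }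
  r :=
    { app := fun X _ _ x => match x with
        | .mk (.mk f g) h => Sig.recast (X := SMTerm X) (Nat.add_assoc _ _ _).symm
            (Nat.add_assoc _ _ _).symm (tens (var f) (tens (var g) (var h)))
      naturality := fun X Y φ => Sig.hom_ext fun n m x => by
        rcases x with ⟨⟨f, g⟩, h⟩; exact (bind_recast φ _ _ (tens (var f) (tens (var g) (var h)))).symm }

/-- `ε ⊗ f ≡ f` -/
def unitTens : MonadEqs SSMFree.{u} where
  A := Id
  l :=
    { app := fun X _ _ f => Sig.recast (X := SMTerm X) (Nat.zero_add _) (Nat.zero_add _)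
        (tens unit (var f))
      naturality := fun X Y φ => Sig.hom_ext fun n m f =>
        (bind_recast φ _ _ (tens unit (var f))).symm }
  r := { app := fun _ _ _ f => var f }

/-- `f ⊗ ε ≡ f` -/
def tensUnit : MonadEqs SSMFree.{u} where
  A := Id
  l := { app := fun _ _ _ f => tens (var f) unit }
  r := { app := fun _ _ _ f => var f }

/-- `σ ; σ ≡ id₂` -/
def symm : MonadEqs SSMFree.{u} where
  A := sigmaF
  l := { app := fun X => ptDesc (comp sw sw)
         naturality := fun X Y φ => Sig.hom_ext fun n m x => by
           rcases x with ⟨⟩; rfl }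
  r := { app := fun X => ptDesc (idn 2)
         naturality := fun X Y φ => Sig.hom_ext fun n m x => by
           rcases x with ⟨⟩; rfl }

/-- `(f ; g) ⊗ (h ; i) ≡ (f ⊗ h) ; (g ⊗ i)` -/
def interchange : MonadEqs SSMFree.{u} where
  A := parF (seqF Id Id) (seqF Id Id)
  l :=
    { app := fun X _ _ x => match x with
        | .mk (.mk f g) (.mk h i) => tens (comp (var f) (var g)) (comp (var h) (var i))
      naturality := fun X Y φ => Sig.hom_ext fun n m x => by
        rcases x with ⟨⟨f, g⟩, ⟨h, i⟩⟩; rfl }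
  r :=
    { app := fun X _ _ x => match x with
        | .mk (.mk f g) (.mk h i) => comp (tens (var f) (var h)) (tens (var g) (var i))
      naturality := fun X Y φ => Sig.hom_ext fun n m x => by
        rcases x with ⟨⟨f, g⟩, ⟨h, i⟩⟩; rfl }

/-- `(f ; g) ; h ≡ f ; (g ; h)` -/
def compAssoc : MonadEqs SSMFree.{u} where
  A := seqF (seqF Id Id) Id
  l :=
    { app := fun X _ _ x => match x with
        | .mk (.mk f g) h => comp (comp (var f) (var g)) (var h)
      naturality := fun X Y φ => Sig.hom_ext fun n m x => by
        rcases x with ⟨⟨f, g⟩, h⟩; rfl }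
  r :=
    { app := fun X _ _ x => match x with
        | .mk (.mk f g) h => comp (var f) (comp (var g) (var h))
      naturality := fun X Y φ => Sig.hom_ext fun n m x => by
        rcases x with ⟨⟨f, g⟩, h⟩; rfl }

/-- `f ; idₘ ≡ f` -/
def compId : MonadEqs SSMFree.{u} where
  A := Id
  l :=
    { app := fun _ _ m f => comp (var f) (idn m)
      naturality := fun X Y φ => Sig.hom_ext fun n m f =>
        congrArg (comp (var (φ n m f))) (bind_idn _ m).symm }
  r := { app := fun _ _ _ f => var f }

/-- `idₙ ; f ≡ f` -/
def idComp : MonadEqs SSMFree.{u} where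
  A := Id
  l :=
    { app := fun _ n _ f => comp (idn n) (var f)
      naturality := fun X Y φ => Sig.hom_ext fun n m f =>
        congrArg (fun t => comp t (var (φ n m f))) (bind_idn _ n).symm }
  r := { app := fun _ _ _ f => var f }

/-- `σ₁ₙ ; (f ⊗ id₁) ≡ (id₁ ⊗ f) ; σ₁ₘ` -/
def sigmaLeft : MonadEqs SSMFree.{u} where
  A := plusOneF Id
  l :=
    { app := fun X => plusOneDesc fun {n m} f =>
        Sig.recast (X := SMTerm X) (Nat.add_comm 1 n) rfl (comp (sigL n) (tens (var f) one))
      naturality := fun X Y φ => Sig.hom_ext fun _ _ x => by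
        rcases x with @⟨n, m, f⟩
        refine Eq.trans ?_ (bind_recast φ (Nat.add_comm 1 n) rfl
          (comp (sigL n) (tens (var f) one))).symm
        exact congrArg (fun t => Sig.recast (X := SMTerm Y) (Nat.add_comm 1 n) rfl
          (comp t (tens (var (φ n m f)) one))) (bind_sigL _ n).symm }
  r :=
    { app := fun X => plusOneDesc fun {n m} f =>
        Sig.recast (X := SMTerm X) (Nat.add_comm 1 n) rfl (comp (tens one (var f)) (sigL m))
      naturality := fun X Y φ => Sig.hom_ext fun _ _ x => by
        rcases x with @⟨n, m, f⟩
        refine Eq.trans ?_ (bind_recast φ (Nat.add_comm 1 n) rfl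
          (comp (tens one (var f)) (sigL m))).symm
        exact congrArg (fun t => Sig.recast (X := SMTerm Y) (Nat.add_comm 1 n) rfl
          (comp (tens one (var (φ n m f))) t)) (bind_sigL _ m).symm }

/-- `σₙ₁ ; (id₁ ⊗ g) ≡ (g ⊗ id₁) ; σₘ₁` -/
def sigmaRight : MonadEqs SSMFree.{u} where
  A := plusOneF Id
  l :=
    { app := fun X => plusOneDesc fun {n m} g =>
        Sig.recast (X := SMTerm X) rfl (Nat.add_comm 1 m) (comp (sigR n) (tens one (var g)))
      naturality := fun X Y φ => Sig.hom_ext fun _ _ x => by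
        rcases x with @⟨n, m, g⟩
        refine Eq.trans ?_ (bind_recast φ rfl (Nat.add_comm 1 m)
          (comp (sigR n) (tens one (var g)))).symm
        exact congrArg (fun t => Sig.recast (X := SMTerm Y) rfl (Nat.add_comm 1 m)
          (comp t (tens one (var (φ n m g))))) (bind_sigR _ n).symm }
  r :=
    { app := fun X => plusOneDesc fun {n m} g =>
        Sig.recast (X := SMTerm X) rfl (Nat.add_comm 1 m) (comp (tens (var g) one) (sigR m))
      naturality := fun X Y φ => Sig.hom_ext fun _ _ x => by
        rcases x with @⟨n, m, g⟩
        refine Eq.trans ?_ (bind_recast φ rfl (Nat.add_comm 1 m)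
          (comp (tens (var g) one) (sigR m))).symm
        exact congrArg (fun t => Sig.recast (X := SMTerm Y) rfl (Nat.add_comm 1 m)
          (comp (tens (var (φ n m g)) one) t)) (bind_sigR _ m).symm }

end SMEq

/-- The equations of symmetric monoidal categories. The functor of variables is
`(Id ⊗ Id ⊗ Id) + Id + Id + σ + ((Id ; Id) ⊗ (Id ; Id)) + (Id ; Id ; Id) + Id + Id + Id⁺¹ + Id⁺¹`. -/
def EqSM : MonadEqs SSMFree.{u} :=
  SMEq.tensAssoc.union <| SMEq.unitTens.union <| SMEq.tensUnit.union <| SMEq.symm.union <|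
    SMEq.interchange.union <| SMEq.compAssoc.union <| SMEq.compId.union <| SMEq.idComp.union <|
      SMEq.sigmaLeft.union SMEq.sigmaRight

/-- The prop monad. -/
noncomputable def SPROP : Monad Sig.{u} := EqSM.quotient

/-- The operations of props, as a natural transformation into the prop monad. -/
noncomputable def SPROP.incl : SSM.{u} ⟶ SPROP.{u}.toFunctor :=
  SSMFree.incl ≫ EqSM.quotientProj.toNatTrans

/-- Restriction of the algebras of a monad along a natural transformation into it. -/
def restrictOps {F : Sig.{u} ⥤ Sig.{u}} {Q : Monad Sig.{u}} (k : F ⟶ Q.toFunctor) :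
    Q.Algebra ⥤ Endofunctor.Algebra F where
  obj B := ⟨B.A, k.app B.A ≫ B.a⟩
  map {B C} f :=
    { f := f.f
      h := by
        have h1 := k.naturality_assoc f.f C.a
        have h2 := congrArg (fun t => k.app B.A ≫ t) f.h
        exact h1.trans (h2.trans (Category.assoc _ _ _).symm) }

/-! ## Props -/

/-- Strict monoidal categories: the associativity and unit isomorphisms are identities. -/
class StrictMonoidal (C : Type*) [Category C] [MonoidalCategory C] : Prop where
  tensor_assoc : ∀ X Y Z : C, (X ⊗ Y) ⊗ Z = X ⊗ (Y ⊗ Z)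
  unit_tensor : ∀ X : C, 𝟙_ C ⊗ X = X
  tensor_unit : ∀ X : C, X ⊗ 𝟙_ C = X
  associator_eq : ∀ X Y Z : C, α_ X Y Z = eqToIso (tensor_assoc X Y Z)
  leftUnitor_eq : ∀ X : C, λ_ X = eqToIso (unit_tensor X)
  rightUnitor_eq : ∀ X : C, ρ_ X = eqToIso (tensor_unit X)

/-- The natural numbers as a set of objects, without the order structure. -/
def Wires : Type := ℕ

/-- Props: symmetric strict monoidal categories with objects the natural numbers, where the
monoidal product on objects is addition. -/
structure PROP : Type (u + 1) where
  [cat : Category.{u} Wires]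
  [mon : MonoidalCategory Wires]
  [sym : SymmetricCategory Wires]
  [strict : StrictMonoidal Wires]
  unit_eq : 𝟙_ Wires = (0 : ℕ)
  tensor_eq : ∀ n m : ℕ, tensorObj (C := Wires) n m = n + m

namespace PROP

/-- The objects of a prop. -/
def Obj (_ : PROP.{u}) : Type := Wires

variable (P : PROP.{u})

instance : Category.{u} P.Obj := P.cat
instance : MonoidalCategory P.Obj := P.mon
instance : SymmetricCategory P.Obj := P.sym

/-- A natural number as an object of a prop. -/
def of (n : ℕ) : P.Obj := n

/-- The arrows from `n` to `m`. -/
def Arr (n m : ℕ) : Type u := P.of n ⟶ P.of m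

theorem of_add (n m : ℕ) : P.of (n + m) = P.of n ⊗ P.of m := (P.tensor_eq n m).symm

/-- The identity on `n`. -/
def ident (n : ℕ) : P.Arr n n := 𝟙 (P.of n)

/-- Composition, in diagrammatic order. -/
def comp {n k m : ℕ} (f : P.Arr n k) (g : P.Arr k m) : P.Arr n m :=
  CategoryStruct.comp (obj := P.Obj) f g

/-- The monoidal product of arrows. -/
def tens {a b c d : ℕ} (f : P.Arr a b) (g : P.Arr c d) : P.Arr (a + c) (b + d) :=
  eqToHom (P.of_add a c) ≫ tensorHom (C := P.Obj) f g ≫ eqToHom (P.of_add b d).symm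

/-- The symmetry of `n` past `m`. -/
def swap (n m : ℕ) : P.Arr (n + m) (m + n) :=
  eqToHom (P.of_add n m) ≫ (β_ (P.of n) (P.of m)).hom ≫ eqToHom (P.of_add m n).symm

/-- The underlying signature of a prop. -/
def sig : Sig.{u} := P.Arr

/-- Prop morphisms: identity-on-objects (strict) symmetric monoidal functors. -/
@[ext]
structure Mor (P Q : PROP.{u}) : Type u where
  map : ∀ n m : ℕ, P.Arr n m → Q.Arr n m
  map_ident : ∀ n, map n n (P.ident n) = Q.ident n
  map_comp : ∀ {n k m : ℕ} (f : P.Arr n k) (g : P.Arr k m),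
    map n m (P.comp f g) = Q.comp (map n k f) (map k m g)
  map_tens : ∀ {a b c d : ℕ} (f : P.Arr a b) (g : P.Arr c d),
    map (a + c) (b + d) (P.tens f g) = Q.tens (map a b f) (map c d g)
  map_swap : ∀ n m, map (n + m) (m + n) (P.swap n m) = Q.swap n m

instance : Category.{u} PROP.{u} where
  Hom := Mor
  id P :=
    { map := fun _ _ f => f
      map_ident := fun _ => rfl
      map_comp := fun _ _ => rfl
      map_tens := fun _ _ => rfl
      map_swap := fun _ _ => rfl }
  comp F G :=
    { map := fun n m f => G.map n m (F.map n m f)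
      map_ident := fun n => by rw [F.map_ident, G.map_ident]
      map_comp := fun f g => by rw [F.map_comp, G.map_comp]
      map_tens := fun f g => by rw [F.map_tens, G.map_tens]
      map_swap := fun n m => by rw [F.map_swap, G.map_swap] }

/-- The interpretation in a prop of the five operations: composition, the identity on `1`, the
monoidal product, the identity on `0`, and the symmetry of `1` past `1`. -/
def ops : SSM.obj P.sig ⟶ P.sig :=
  SSM.desc (X := P.sig) (Y := P.sig) P.comp (P.ident 1) P.tens (P.ident 0) (P.swap 1 1)

theorem ops_natural {P Q : PROP.{u}} (F : P ⟶ Q) :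
    SSM.map (X := P.sig) (Y := Q.sig) F.map ≫ Q.ops = P.ops ≫ (F.map : P.sig ⟶ Q.sig) :=
  Sig.hom_ext fun n m t => by
    rcases t with ⟨⟨f, g⟩⟩ | ⟨⟨⟩⟩ | ⟨⟨f, g⟩⟩ | ⟨⟨⟩⟩ | ⟨⟨⟩⟩
    · exact (F.map_comp f g).symm
    · exact (F.map_ident 1).symm
    · exact (F.map_tens f g).symm
    · exact (F.map_ident 0).symm
    · exact (F.map_swap 1 1).symm

/-- The functor which remembers only the arrows of a prop and the five operations. -/
def toOps : PROP.{u} ⥤ Endofunctor.Algebra SSM.{u} where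
  obj P := ⟨P.sig, P.ops⟩
  map F := { f := F.map, h := ops_natural F }

end PROP

/-! ## Carboni–Walters props -/

/-- The signature of a Frobenius bimonoid: comultiplication, counit, multiplication, unit. -/
def Frob : Sig.{u} := Sig.sum (Pt 1 2) (Sig.sum (Pt 1 0) (Sig.sum (Pt 2 1) (Pt 0 1)))

/-- The substitution of terms of `T (X + K)` for variables, leaving the constants alone. -/
def addConstSub (T : Monad Sig.{u}) (K X : Sig.{u}) :
    Sig.sum (T.obj (Sig.sum X K)) K ⟶ T.obj (Sig.sum X K) :=
  Sig.desc (𝟙 _) (Sig.inr ≫ T.η.app (Sig.sum X K))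

/-- The coproduct, in the category of monads, of the monad `T` and the free monad on the
functor constant at `K`: the monad `X ↦ T (X + K)`. -/
def addConst (T : Monad Sig.{u}) (K : Sig.{u}) : Monad Sig.{u} where
  obj X := T.obj (Sig.sum X K)
  map f := T.map (Sig.desc (f ≫ Sig.inl) Sig.inr)
  map_id X := by
    rw [← T.map_id]
    exact congrArg _ (Sig.sum_ext rfl rfl)
  map_comp f g := by
    rw [← T.map_comp]
    exact congrArg _ (Sig.sum_ext rfl rfl)
  η :=
    { app := fun X => Sig.inl ≫ T.η.app (Sig.sum X K)
      naturality := fun X Y f => by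
        rw [Category.assoc, ← T.unit_naturality]
        rfl }
  μ :=
    { app := fun X => T.map (addConstSub T K X) ≫ T.μ.app (Sig.sum X K)
      naturality := fun X Y f => by
        change T.map (Sig.desc (T.map (Sig.desc (f ≫ Sig.inl) Sig.inr) ≫ Sig.inl) Sig.inr) ≫
          T.map (addConstSub T K Y) ≫ T.μ.app (Sig.sum Y K) =
          (T.map (addConstSub T K X) ≫ T.μ.app (Sig.sum X K)) ≫
            T.map (Sig.desc (f ≫ Sig.inl) Sig.inr)
        rw [Category.assoc, ← T.mu_naturality, ← T.map_comp_assoc, ← T.map_comp_assoc]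
        refine congrArg (fun k => T.map k ≫ T.μ.app (Sig.sum Y K)) (Sig.sum_ext rfl ?_)
        have h := congrArg (fun k => (Sig.inr : K ⟶ _) ≫ k)
          (Monad.unit_naturality Sig T (Sig.desc (f ≫ Sig.inl) (Sig.inr : K ⟶ _)))
        exact h }
  assoc X := by
    have h : Sig.desc ((T.map (addConstSub T K X) ≫ T.μ.app (Sig.sum X K)) ≫ Sig.inl) Sig.inr ≫
        addConstSub T K X = addConstSub T K (T.obj (Sig.sum X K)) ≫
          T.map (addConstSub T K X) ≫ T.μ.app (Sig.sum X K) := by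
      refine Sig.sum_ext rfl ?_
      change Sig.inr ≫ T.η.app (Sig.sum X K) = Sig.inr ≫
        T.η.app (Sig.sum (T.obj (Sig.sum X K)) K) ≫
          T.map (addConstSub T K X) ≫ T.μ.app (Sig.sum X K)
      rw [← Monad.unit_naturality_assoc, T.left_unit]
      rfl
    have h1 : T.map (Sig.desc ((T.map (addConstSub T K X) ≫ T.μ.app (Sig.sum X K)) ≫ Sig.inl)
          Sig.inr) ≫ T.map (addConstSub T K X) ≫ T.μ.app (Sig.sum X K) =
        (T.map (addConstSub T K (T.obj (Sig.sum X K))) ≫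
          T.μ.app (Sig.sum (T.obj (Sig.sum X K)) K)) ≫
          T.map (addConstSub T K X) ≫ T.μ.app (Sig.sum X K) := by
      rw [← T.map_comp_assoc, h, Category.assoc, ← Monad.mu_naturality_assoc, ← T.assoc,
        T.map_comp_assoc, T.map_comp_assoc]
    exact h1
  left_unit X := by
    change Sig.inl ≫ T.η.app (Sig.sum (T.obj (Sig.sum X K)) K) ≫
      T.map (addConstSub T K X) ≫ T.μ.app (Sig.sum X K) = 𝟙 (T.obj (Sig.sum X K))
    rw [← Monad.unit_naturality_assoc, T.left_unit]
    rfl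
  right_unit X := by
    have h : Sig.desc ((Sig.inl ≫ T.η.app (Sig.sum X K)) ≫ Sig.inl) Sig.inr ≫
        addConstSub T K X = T.η.app (Sig.sum X K) := Sig.sum_ext rfl rfl
    have h1 : T.map (Sig.desc ((Sig.inl ≫ T.η.app (Sig.sum X K)) ≫ Sig.inl) Sig.inr) ≫
        T.map (addConstSub T K X) ≫ T.μ.app (Sig.sum X K) = 𝟙 (T.obj (Sig.sum X K)) := by
      rw [← T.map_comp_assoc, h, T.right_unit]
      rfl
    exact h1

/-- The inclusion of the monad `T`. -/
def addConst.inl (T : Monad Sig.{u}) (K : Sig.{u}) : T ⟶ addConst T K where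
  app X := T.map Sig.inl
  naturality X Y f := by
    change T.map f ≫ T.map Sig.inl = T.map Sig.inl ≫ T.map (Sig.desc (f ≫ Sig.inl) Sig.inr)
    rw [← T.map_comp, ← T.map_comp]
    rfl
  app_η X := (Monad.unit_naturality Sig T _).symm
  app_μ X := by
    change T.μ.app X ≫ T.map Sig.inl = (T.map (T.map Sig.inl) ≫ T.map Sig.inl) ≫
      T.map (addConstSub T K X) ≫ T.μ.app (Sig.sum X K)
    have h : (Sig.inl : T.obj (Sig.sum X K) ⟶ Sig.sum _ K) ≫ addConstSub T K X = 𝟙 _ := rfl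
    rw [← T.mu_naturality, Category.assoc, ← T.map_comp_assoc Sig.inl, h, T.map_id,
      Category.id_comp]

/-- The inclusion of the constants. -/
def addConst.inr (T : Monad Sig.{u}) (K : Sig.{u}) : constF K ⟶ (addConst T K).toFunctor where
  app X := Sig.inr ≫ T.η.app (Sig.sum X K)
  naturality X Y f := by
    change Sig.inr ≫ T.η.app (Sig.sum Y K) =
      (Sig.inr ≫ T.η.app (Sig.sum X K)) ≫ T.map (Sig.desc (f ≫ Sig.inl) Sig.inr)
    rw [Category.assoc, ← T.unit_naturality]
    rfl

/-- `S`, with `i` and `k`, is the coproduct, in the category of monads, of `T` and the free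
monad on the functor constant at `K`: monad morphisms out of `S` correspond to pairs of a monad
morphism out of `T` and a natural transformation out of the constant functor. -/
def IsCoproductConst {T S : Monad Sig.{u}} {K : Sig.{u}} (i : T ⟶ S)
    (k : constF K ⟶ S.toFunctor) : Prop :=
  ∀ (M : Monad Sig.{u}) (φ : T ⟶ M) (k' : constF K ⟶ M.toFunctor),
    ∃! ψ : S ⟶ M, i ≫ ψ = φ ∧ k ≫ ψ.toNatTrans = k'

/-- The monad of props with the operations of a Frobenius bimonoid, without equations on them. -/
noncomputable def SFR : Monad Sig.{u} := addConst SPROP Frob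

/-- The nine equations of special Frobenius bimonoids, with their types. -/
inductive FrobLaw : ℕ → ℕ → Type u
  | coassoc : FrobLaw 1 3
  | cocomm : FrobLaw 1 2
  | counit : FrobLaw 1 1
  | assoc : FrobLaw 3 1
  | comm : FrobLaw 2 1
  | unit : FrobLaw 1 1
  | special : FrobLaw 1 1
  | frobLeft : FrobLaw 2 2
  | frobRight : FrobLaw 2 2

namespace FrobLaw

open SMTerm

/-- Comultiplication. -/
def cm : SMTerm Frob.{u} 1 2 := var (Sum.inl Pt.pt)
/-- Counit. -/
def cu : SMTerm Frob.{u} 1 0 := var (Sum.inr (Sum.inl Pt.pt))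
/-- Multiplication. -/
def ml : SMTerm Frob.{u} 2 1 := var (Sum.inr (Sum.inr (Sum.inl Pt.pt)))
/-- Unit. -/
def un : SMTerm Frob.{u} 0 1 := var (Sum.inr (Sum.inr (Sum.inr Pt.pt)))

/-- The left-hand sides. -/
def lhs : ∀ n m : ℕ, FrobLaw.{u} n m → SMTerm Frob.{u} n m
  | _, _, coassoc => comp cm (tens cm one)
  | _, _, cocomm => comp cm sw
  | _, _, counit => comp cm (tens cu one)
  | _, _, assoc => comp (tens ml one) ml
  | _, _, comm => comp sw ml
  | _, _, unit => comp (tens un one) ml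
  | _, _, special => comp cm ml
  | _, _, frobLeft => comp (tens cm one) (tens one ml)
  | _, _, frobRight => comp (tens one cm) (tens ml one)

/-- The right-hand sides. -/
def rhs : ∀ n m : ℕ, FrobLaw.{u} n m → SMTerm Frob.{u} n m
  | _, _, coassoc => comp cm (tens one cm)
  | _, _, cocomm => cm
  | _, _, counit => one
  | _, _, assoc => comp (tens one ml) ml
  | _, _, comm => ml
  | _, _, unit => one
  | _, _, special => one
  | _, _, frobLeft => comp ml cm
  | _, _, frobRight => comp ml cm

end FrobLaw

/-- A family of closed terms over the Frobenius signature, as a natural transformation. -/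
noncomputable def SFR.closed {L : Sig.{u}} (t : ∀ n m : ℕ, L n m → SMTerm Frob.{u} n m) :
    constF L ⟶ SFR.{u}.toFunctor where
  app X := (t : L ⟶ SSMFree.obj Frob) ≫ EqSM.quotientProj.app Frob ≫ SPROP.map Sig.inr
  naturality X Y f := by
    have h : (Sig.inr : Frob ⟶ Sig.sum X Frob) ≫ Sig.desc (f ≫ Sig.inl) Sig.inr =
      (Sig.inr : Frob ⟶ Sig.sum Y Frob) := rfl
    have h1 := congrArg (fun k => (t : L ⟶ SSMFree.obj Frob) ≫ EqSM.quotientProj.app Frob ≫ k)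
      ((congrArg SPROP.map h).symm.trans (SPROP.map_comp _ _))
    exact h1

/-- The equations of special Frobenius bimonoids. -/
noncomputable def EqCW : MonadEqs SFR.{u} where
  A := constF FrobLaw
  l := SFR.closed FrobLaw.lhs
  r := SFR.closed FrobLaw.rhs

/-- The Carboni–Walters monad. -/
noncomputable def SCW : Monad Sig.{u} := EqCW.quotient

/-- The signature functor of the operations of Carboni–Walters props. -/
def SSMFrob : Sig.{u} ⥤ Sig.{u} := sumF SSM (constF Frob)

/-- The operations of Carboni–Walters props, as a natural transformation into the monad. -/
noncomputable def SCW.incl : SSMFrob.{u} ⟶ SCW.{u}.toFunctor where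
  app X := Sig.desc
    ((SPROP.incl ≫ (addConst.inl SPROP Frob).toNatTrans ≫ EqCW.quotientProj.toNatTrans).app X)
    ((addConst.inr SPROP Frob ≫ EqCW.quotientProj.toNatTrans).app X)
  naturality X Y f := Sig.sum_ext
    ((SPROP.incl ≫ (addConst.inl SPROP Frob).toNatTrans ≫
      EqCW.quotientProj.toNatTrans).naturality f)
    ((addConst.inr SPROP Frob ≫ EqCW.quotientProj.toNatTrans).naturality f)

/-- Carboni–Walters props: props with a special Frobenius bimonoid on the object `1`. -/
structure CWP : Type (u + 1) where
  P : PROP.{u}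
  cm : P.Arr 1 2
  cu : P.Arr 1 0
  ml : P.Arr 2 1
  un : P.Arr 0 1
  coassoc : P.comp cm (P.tens cm (P.ident 1)) = P.comp cm (P.tens (P.ident 1) cm)
  cocomm : P.comp cm (P.swap 1 1) = cm
  counit : P.comp cm (P.tens cu (P.ident 1)) = P.ident 1
  assoc : P.comp (P.tens ml (P.ident 1)) ml = P.comp (P.tens (P.ident 1) ml) ml
  comm : P.comp (P.swap 1 1) ml = ml
  unit : P.comp (P.tens un (P.ident 1)) ml = P.ident 1
  special : P.comp cm ml = P.ident 1
  frobLeft : P.comp (n := 2) (k := 3) (m := 2) (P.tens cm (P.ident 1))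
    (P.tens (P.ident 1) ml) = P.comp ml cm
  frobRight : P.comp (n := 2) (k := 3) (m := 2) (P.tens (P.ident 1) cm)
    (P.tens ml (P.ident 1)) = P.comp ml cm

namespace CWP

/-- Prop morphisms which preserve the Frobenius bimonoid. -/
@[ext]
structure Mor (C D : CWP.{u}) : Type u where
  F : C.P ⟶ D.P
  map_cm : F.map 1 2 C.cm = D.cm
  map_cu : F.map 1 0 C.cu = D.cu
  map_ml : F.map 2 1 C.ml = D.ml
  map_un : F.map 0 1 C.un = D.un

instance : Category.{u} CWP.{u} where
  Hom := Mor
  id C := { F := 𝟙 C.P, map_cm := rfl, map_cu := rfl, map_ml := rfl, map_un := rfl }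
  comp f g :=
    { F := f.F ≫ g.F
      map_cm := (congrArg _ f.map_cm).trans g.map_cm
      map_cu := (congrArg _ f.map_cu).trans g.map_cu
      map_ml := (congrArg _ f.map_ml).trans g.map_ml
      map_un := (congrArg _ f.map_un).trans g.map_un }

/-- The Frobenius operations. -/
def frob (C : CWP.{u}) : Frob ⟶ C.P.sig :=
  Sig.desc (ptDesc C.cm) (Sig.desc (ptDesc C.cu) (Sig.desc (ptDesc C.ml) (ptDesc C.un)))

/-- The functor which remembers only the arrows of a Carboni–Walters prop and its operations. -/
def toOps : CWP.{u} ⥤ Endofunctor.Algebra SSMFrob.{u} where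
  obj C := ⟨C.P.sig, Sig.desc C.P.ops C.frob⟩
  map {C D} f :=
    { f := f.F.map
      h := Sig.sum_ext (PROP.ops_natural f.F) (Sig.hom_ext fun n m x => by
        rcases x with ⟨⟨⟩⟩ | ⟨⟨⟩⟩ | ⟨⟨⟩⟩ | ⟨⟨⟩⟩
        · exact f.map_cm.symm
        · exact f.map_cu.symm
        · exact f.map_ml.symm
        · exact f.map_un.symm) }

end CWP

end StringDiag

/-! The core is the comparison of algebras of the prop monad with props. An algebra of the term
monad is the same thing as an interpretation `o` of the five operations, since its structure map is
evaluation of terms (`SSMFree.a_eq_eval`). The structure map factors through the generated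
congruence exactly when the equations hold (`isQuotientMonad_quotient`), and for `EqSM` this means
that `o` satisfies `SMLaws` (`sat_EqSM_iff`). It remains to identify such interpretations with
props.

Strict associativity holds only along equalities such as `(a + c) + e = a + (c + e)`. Equations are
therefore proved in the total space `Op o` of operations of all types, where transports and
`eqToHom` disappear.

A prop has symmetries for all pairs `n`, `m`, whereas the equations speak of the basic crossing and
of sliding one operation past one wire. The general symmetry `braid` is defined by recursion from
`sigR`. The first hexagon (`braid_add_right`) is essentially that recursion; the second
(`braid_add_left`) also exchanges crossings on disjoint wires. Naturality on the two sides comes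
from the two sliding equations, and `braid_symm` from the involutivity of the basic crossing.
Conversely, the hexagons of any prop force its symmetry to be `braid` (`PROP.op_swap_eq`). So a prop
is determined by its arrows and the five operations (`SMLaws.toPROP_eq`, using `PROP.ext_of`), and a
map preserving these preserves every symmetry (`Op.map_braid`).

The functors in both directions keep signatures and underlying maps, so `functor_eq_of_faithful`
reduces the isomorphism of categories to equalities of objects.

For the Frobenius operations, an algebra of `X ↦ T (X + K)` is a `T`-algebra with a map out of `K`
(`addConst.alg_factor`); the coproduct property is the same calculation for monad morphisms. The
closed terms of the Frobenius laws evaluate to the equations in `CWP` (`SFR.closed_a`), so the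
comparison of props carries over. -/

namespace StringDiag

/-! ### Spans and families -/

instance : fibres.{u}.Faithful where
  map_injective {X _ _ _} h := SpanSig.Mor.ext (funext fun x =>
    congrArg Subtype.val (congrFun (congrFun (congrFun h (X.ar x)) (X.coar x)) ⟨x, rfl, rfl⟩))

instance : fibres.{u}.Full where
  map_surjective {X Y} f :=
    ⟨⟨fun x => (f (X.ar x) (X.coar x) ⟨x, rfl, rfl⟩).1,
      fun x => (f (X.ar x) (X.coar x) ⟨x, rfl, rfl⟩).2.1,
      fun x => (f (X.ar x) (X.coar x) ⟨x, rfl, rfl⟩).2.2⟩,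
    Sig.hom_ext fun n m x => by
      obtain ⟨x, rfl, rfl⟩ := x
      rfl⟩

/-- The total space of a signature, as a span. -/
def Sig.toSpan (X : Sig.{u}) : SpanSig.{u} where
  carrier := Σ n m : ℕ, X n m
  ar x := x.1
  coar x := x.2.1

/-- The fibres of the total space of a signature. -/
def Sig.fibresToSpan (X : Sig.{u}) : fibres.obj X.toSpan ≅ X where
  hom := fun n m x => Sig.recast x.2.1 x.2.2 x.1.2.2
  inv := fun n m x => ⟨⟨n, m, x⟩, rfl, rfl⟩
  hom_inv_id := Sig.hom_ext fun n m x => by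
    obtain ⟨x, rfl, rfl⟩ := x
    rfl
  inv_hom_id := rfl

instance : fibres.{u}.EssSurj where
  mem_essImage X := ⟨X.toSpan, ⟨X.fibresToSpan⟩⟩

theorem fibres_isEquivalence : fibres.{u}.IsEquivalence where

/-! ### Terms and the free monad -/

/-- The evaluation of terms in an interpretation of the five operations. -/
def SMTerm.eval {X A : Sig.{u}} (o : SSM.obj A ⟶ A) (v : X ⟶ A) :
    ∀ {n m : ℕ}, SMTerm X n m → A n m
  | _, _, var x => v _ _ x
  | _, _, comp s t => o _ _ (Sum.inl (.mk (eval o v s) (eval o v t)))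
  | _, _, one => o _ _ (Sum.inr (Sum.inl .pt))
  | _, _, tens s t => o _ _ (Sum.inr (Sum.inr (Sum.inl (.mk (eval o v s) (eval o v t)))))
  | _, _, unit => o _ _ (Sum.inr (Sum.inr (Sum.inr (Sum.inl .pt))))
  | _, _, sw => o _ _ (Sum.inr (Sum.inr (Sum.inr (Sum.inr .pt))))

/-- Evaluation is a morphism of algebras for the operations. -/
theorem SMTerm.op_eval {X A : Sig.{u}} (o : SSM.obj A ⟶ A) (v : X ⟶ A) :
    SSMFree.op.app X ≫ (fun _ _ t => t.eval o v : SSMFree.obj X ⟶ A) =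
      SSM.map (X := SSMFree.obj X) (fun _ _ t => t.eval o v) ≫ o :=
  Sig.hom_ext fun n m t => by
    rcases t with ⟨⟨⟩⟩ | ⟨⟨⟩⟩ | ⟨⟨⟩⟩ | ⟨⟨⟩⟩ | ⟨⟨⟩⟩ <;> rfl

/-- A morphism of algebras out of the terms is evaluation. -/
theorem SMTerm.eq_eval {X A : Sig.{u}} (o : SSM.obj A ⟶ A) (h : SSMFree.obj X ⟶ A)
    (hh : SSMFree.op.app X ≫ h = SSM.map h ≫ o) {n m : ℕ} (t : SMTerm X n m) :
    h n m t = t.eval o (fun _ _ x => h _ _ (var x)) := by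
  have H := fun n m t => congrFun (congrFun (congrFun hh n) m) t
  induction t with
  | var x => rfl
  | comp s t hs ht =>
    exact (H _ _ (Sum.inl (.mk s t))).trans
      (congrArg₂ (fun a b => o _ _ (Sum.inl (.mk a b))) hs ht)
  | one => exact H _ _ (Sum.inr (Sum.inl .pt))
  | tens s t hs ht =>
    exact (H _ _ (Sum.inr (Sum.inr (Sum.inl (.mk s t))))).trans
      (congrArg₂ (fun a b => o _ _ (Sum.inr (Sum.inr (Sum.inl (.mk a b))))) hs ht)
  | unit => exact H _ _ (Sum.inr (Sum.inr (Sum.inr (Sum.inl .pt))))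
  | sw => exact H _ _ (Sum.inr (Sum.inr (Sum.inr (Sum.inr .pt))))

/-- Both maps are evaluation, and evaluation depends only on the values of the variables. -/
theorem SSMFree.hom_ext {X A : Sig.{u}} (o : SSM.obj A ⟶ A) {h k : SSMFree.obj X ⟶ A}
    (hh : SSMFree.op.app X ≫ h = SSM.map h ≫ o) (hk : SSMFree.op.app X ≫ k = SSM.map k ≫ o)
    (e : SSMFree.η.app X ≫ h = SSMFree.η.app X ≫ k) : h = k :=
  Sig.hom_ext fun n m t => by
    refine (SMTerm.eq_eval o h hh t).trans (Eq.trans ?_ (SMTerm.eq_eval o k hk t).symm)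
    exact congrArg (fun v : X ⟶ A => SMTerm.eval o v t) e

theorem SSMFree.op_mul (X : Sig.{u}) :
    SSMFree.op.app (SSMFree.obj X) ≫ SSMFree.μ.app X =
      SSM.map (SSMFree.μ.app X) ≫ SSMFree.op.app X :=
  Sig.hom_ext fun n m t => by
    rcases t with ⟨⟨⟩⟩ | ⟨⟨⟩⟩ | ⟨⟨⟩⟩ | ⟨⟨⟩⟩ | ⟨⟨⟩⟩ <;> rfl

/-- An algebra for the sum of the constant functor at `X` and `SSM` consists of a valuation of the
variables and an interpretation of the operations; evaluation is the unique morphism to it. -/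
theorem isFreeMonad_SSMFree : IsFreeMonad.{u} SSM SSMFree SSMFree.op where
  initial X := ⟨Limits.IsInitial.ofUniqueHom
    (fun B =>
      { f := fun _ _ t => t.eval (Sig.inr ≫ B.str) (Sig.inl ≫ B.str)
        h := Sig.sum_ext rfl (SMTerm.op_eval (X := X) (Sig.inr ≫ B.str) (Sig.inl ≫ B.str)).symm })
    (fun B h => by
      have h1 : Sig.desc (Sig.inl : X ⟶ Sig.sum X (SSM.obj B.a)) (SSM.map h.f ≫ Sig.inr) ≫ B.str =
        Sig.desc (SSMFree.η.app X) (SSMFree.op.app X) ≫ h.f := h.h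
      have hop : SSMFree.op.app X ≫ h.f = SSM.map h.f ≫ Sig.inr ≫ B.str :=
        (congrArg (fun k => Sig.inr ≫ k) h1).symm
      have hvar : SSMFree.η.app X ≫ h.f = Sig.inl ≫ B.str :=
        (congrArg (fun k => Sig.inl ≫ k) h1).symm
      exact Endofunctor.Algebra.Hom.ext
        (SSMFree.hom_ext (Sig.inr ≫ B.str) hop (SMTerm.op_eval _ _) hvar))⟩
  mul X := SSMFree.op_mul X

/-! ### Quotients of monads -/

theorem epi_of_section {X Y : Sig.{u}} (f : X ⟶ Y) (s : Y ⟶ X) (h : s ≫ f = 𝟙 Y) : Epi f where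
  left_cancellation g k e := by
    have := congrArg (fun t => s ≫ t) e
    simpa only [← Category.assoc, h, Category.id_comp] using this

namespace MonadEqs

variable {T : Monad Sig.{u}} (E : MonadEqs T)

/-- Puts the structure map among the homomorphisms whose kernels are intersected in `congr`, so that
it descends to the quotient. Associativity makes it a homomorphism, and naturality carries the
equations from `B.A` to the free algebra. -/
theorem respects_a (B : T.Algebra) (h : E.Sat B) : E.Respects B B.a where
  hom := B.assoc.symm
  eqs := by
    have key : ∀ k : E.A ⟶ T.toFunctor, k.app (T.obj B.A) ≫ T.μ.app B.A ≫ B.a =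
        E.A.map B.a ≫ k.app B.A ≫ B.a := fun k => by
      rw [k.naturality_assoc, B.assoc]
    rw [key, key, show E.l.app B.A ≫ B.a = E.r.app B.A ≫ B.a from h]

/-- The congruence is generated by instances at `T X`; precomposing with the unit recovers the
equations at `X` itself. -/
theorem l_proj (X : Sig.{u}) : E.l.app X ≫ E.proj X = E.r.app X ≫ E.proj X :=
  Sig.hom_ext fun n m x => Quotient.sound fun B h hh => by
    have key : ∀ k : E.A ⟶ T.toFunctor, E.A.map (T.η.app X) ≫ k.app (T.obj X) ≫ T.μ.app X =
        k.app X := fun k => by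
      rw [k.naturality_assoc, T.right_unit]
      exact Category.comp_id _
    have e := congrArg (fun t => E.A.map (T.η.app X) ≫ t) hh.eqs
    have e1 : E.l.app X ≫ h = E.r.app X ≫ h := by
      rw [← key E.l, ← key E.r]
      simpa only [Category.assoc] using e
    exact congrFun (congrFun (congrFun e1 n) m) x

/-- An algebra which satisfies the equations, as an algebra of the quotient. -/
noncomputable def liftAlg (B : T.Algebra) (h : E.Sat B) : E.quotient.Algebra where
  A := B.A
  a := E.lift B.a fun _ _ _ _ H => H B B.a (E.respects_a B h)
  unit := B.unit
  assoc := by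
    -- Both `proj` and its image under `T` can be cancelled, so associativity may be checked on `T
    -- (T B.A)`, where it is that of `B`.
    apply E.proj_cancel
    apply E.map_proj_cancel
    change T.map (E.proj B.A) ≫ E.quotStr B.A ≫ E.lift B.a _ =
      T.map (E.proj B.A) ≫ T.map (E.lift B.a _) ≫ B.a
    rw [← Category.assoc, E.map_proj_quotStr, ← T.map_comp_assoc, E.proj_lift, Category.assoc,
      E.proj_lift, B.assoc]

/-- The restricted structure map factors through `proj`, which already identifies the two sides. -/
theorem sat_restrict (B : E.quotient.Algebra) :
    E.Sat ((Monad.algebraFunctorOfMonadHom E.quotientProj).obj B) := by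
  have h (b : E.quotObj B.A ⟶ B.A) :
      E.l.app B.A ≫ E.proj B.A ≫ b = E.r.app B.A ≫ E.proj B.A ≫ b := by
    rw [← Category.assoc, E.l_proj, Category.assoc]
  exact h B.a

theorem isQuotientMonad_quotient : IsQuotientMonad E E.quotient E.quotientProj where
  epi X := epi_of_section _ (E.sec X) (E.sec_proj X)
  algebras B := ⟨fun h => ⟨E.liftAlg B h, rfl⟩, by
    rintro ⟨B', rfl⟩
    exact E.sat_restrict B'⟩

theorem sat_union (E' : MonadEqs T) (B : T.Algebra) :
    (E.union E').Sat B ↔ E.Sat B ∧ E'.Sat B :=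
  ⟨fun h => ⟨congrArg (fun k => Sig.inl ≫ k) h, congrArg (fun k => Sig.inr ≫ k) h⟩,
    fun h => Sig.sum_ext h.1 h.2⟩

end MonadEqs

theorem algebra_ext {T : Monad Sig.{u}} {B C : T.Algebra} (hA : B.A = C.A) (ha : HEq B.a C.a) :
    B = C := by
  cases B; cases C; cases hA; cases ha; rfl

/-- Functors which agree on objects and after composition with a faithful functor are equal. -/
theorem functor_eq_of_faithful {C D E : Type*} [Category C] [Category D] [Category E]
    {F G : C ⥤ D} (U : D ⥤ E) [U.Faithful] (ho : ∀ X, F.obj X = G.obj X) (h : F ⋙ U = G ⋙ U) :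
    F = G :=
  CategoryTheory.Functor.ext ho fun X Y f => U.map_injective (by
    have := Functor.congr_hom h f
    simpa only [Functor.comp_map, Functor.map_comp, eqToHom_map] using this)

/-! ### Adjoining constants to a monad -/

namespace addConst

variable (T : Monad Sig.{u}) (K : Sig.{u})

/-- An algebra of `X ↦ T (X + K)` is determined by its restriction to `T` and its values on the
constants. By the unit law these values and the identity of the carrier assemble to the structure
map on generators; associativity does the rest. -/
theorem alg_factor (B : (addConst T K).Algebra) :
    T.map (Sig.desc (𝟙 _) ((inr T K).app B.A ≫ B.a)) ≫ (inl T K).app B.A ≫ B.a = B.a := by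
  obtain ⟨A, b, hu, ha⟩ := B
  change T.obj (Sig.sum A K) ⟶ A at b
  replace hu : Sig.inl ≫ T.η.app (Sig.sum A K) ≫ b = 𝟙 A := hu
  replace ha : T.map (addConstSub T K A) ≫ T.μ.app (Sig.sum A K) ≫ b =
    T.map (Sig.desc (b ≫ Sig.inl) Sig.inr) ≫ b := ha
  change T.map (Sig.desc (𝟙 A) (Sig.inr ≫ T.η.app (Sig.sum A K) ≫ b)) ≫ T.map Sig.inl ≫ b = b
  have h1 : Sig.desc (𝟙 A) (Sig.inr ≫ T.η.app (Sig.sum A K) ≫ b) =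
    T.η.app (Sig.sum A K) ≫ b := Sig.sum_ext hu.symm rfl
  -- Associativity restricted to terms without outer constants: there `addConstSub` is the identity.
  have h2 : T.map b ≫ T.map (Sig.inl : A ⟶ Sig.sum A K) ≫ b = T.μ.app (Sig.sum A K) ≫ b := by
    have e := congrArg (fun k => T.map Sig.inl ≫ k) ha
    have e1 : (Sig.inl : T.obj (Sig.sum A K) ⟶ Sig.sum _ K) ≫ addConstSub T K A = 𝟙 _ := rfl
    have e2 : (Sig.inl : T.obj (Sig.sum A K) ⟶ Sig.sum _ K) ≫
      Sig.desc (b ≫ Sig.inl) Sig.inr = b ≫ Sig.inl := rfl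
    simp only [← T.map_comp_assoc, e1, e2, T.map_id, Category.id_comp] at e
    rw [← T.map_comp_assoc, e]
  rw [h1, T.map_comp_assoc, h2, ← Category.assoc, T.right_unit]
  exact Category.id_comp _

variable {T K}

/-- An algebra with an interpretation of the constants. -/
def mkAlg (B : T.Algebra) (k : K ⟶ B.A) : (addConst T K).Algebra where
  A := B.A
  a := T.map (Sig.desc (𝟙 _) k) ≫ B.a
  unit := by
    change Sig.inl ≫ T.η.app (Sig.sum B.A K) ≫ T.map (Sig.desc (𝟙 _) k) ≫ B.a = 𝟙 B.A
    rw [← Monad.unit_naturality_assoc, B.unit]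
    rfl
  assoc := by
    change (T.map (addConstSub T K B.A) ≫ T.μ.app (Sig.sum B.A K)) ≫
        T.map (Sig.desc (𝟙 _) k) ≫ B.a =
      T.map (Sig.desc ((T.map (Sig.desc (𝟙 _) k) ≫ B.a) ≫ Sig.inl) Sig.inr) ≫
        T.map (Sig.desc (𝟙 _) k) ≫ B.a
    have h : addConstSub T K B.A ≫ T.map (Sig.desc (𝟙 _) k) ≫ B.a =
        Sig.desc ((T.map (Sig.desc (𝟙 _) k) ≫ B.a) ≫ Sig.inl) Sig.inr ≫ Sig.desc (𝟙 _) k := by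
      refine Sig.sum_ext rfl ?_
      change Sig.inr ≫ T.η.app (Sig.sum B.A K) ≫ T.map (Sig.desc (𝟙 _) k) ≫ B.a = k
      rw [← Monad.unit_naturality_assoc, B.unit]
      rfl
    rw [Category.assoc, ← Monad.mu_naturality_assoc, B.assoc, ← T.map_comp_assoc,
      ← T.map_comp_assoc, ← T.map_comp_assoc, ← h]
    simp only [Category.assoc]

/-- With `inr_mkAlg` and `alg_factor`, this shows that `mkAlg` inverts the passage to the restricted
algebra and the interpreted constants. -/
theorem restrict_mkAlg_a (B : T.Algebra) (k : K ⟶ B.A) :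
    ((Monad.algebraFunctorOfMonadHom (inl T K)).obj (mkAlg B k)).a = B.a := by
  change T.map Sig.inl ≫ T.map (Sig.desc (𝟙 _) k) ≫ B.a = B.a
  rw [← T.map_comp_assoc]
  exact (congrArg (fun t => t ≫ B.a) (T.map_id B.A)).trans (Category.id_comp _)

theorem inr_mkAlg (B : T.Algebra) (k : K ⟶ B.A) :
    (inr T K).app B.A ≫ (mkAlg B k).a = k := by
  change Sig.inr ≫ T.η.app (Sig.sum B.A K) ≫ T.map (Sig.desc (𝟙 _) k) ≫ B.a = k
  rw [← Monad.unit_naturality_assoc, B.unit]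
  rfl

section Coproduct

variable {M : Monad Sig.{u}} (φ : T ⟶ M) (k : constF K ⟶ M.toFunctor)

/-- The substitution of the interpretations of the constants. -/
def interp (X : Sig.{u}) : Sig.sum X K ⟶ M.obj X := Sig.desc (M.η.app X) (k.app X)

/-- The constant functor sends every map to an identity, so the interpretations of the constants at
different signatures are related by `M` alone. -/
theorem const_naturality {X Y : Sig.{u}} (f : X ⟶ Y) : k.app X ≫ M.map f = k.app Y :=
  (k.naturality f).symm

theorem interp_naturality {X Y : Sig.{u}} (f : X ⟶ Y) :
    Sig.desc (f ≫ Sig.inl) Sig.inr ≫ interp k Y = interp k X ≫ M.map f :=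
  Sig.sum_ext (Monad.unit_naturality Sig M f) (const_naturality k f).symm

/-- The component at `X` of the induced morphism of monads. -/
def copairApp (X : Sig.{u}) : T.obj (Sig.sum X K) ⟶ M.obj X :=
  T.map (interp k X) ≫ φ.app (M.obj X) ≫ M.μ.app X

theorem unit_copairApp (X : Sig.{u}) :
    T.η.app (Sig.sum X K) ≫ copairApp φ k X = interp k X := by
  have h := Monad.unit_naturality_assoc Sig T (interp k X) (φ.app (M.obj X) ≫ M.μ.app X)
  rw [φ.app_η_assoc, M.left_unit] at h
  exact h.symm

/-- The morphism of monads induced by a morphism of monads and an interpretation of the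
constants. -/
def copair : addConst T K ⟶ M where
  app X := copairApp φ k X
  naturality X Y f := by
    change T.map (Sig.desc (f ≫ Sig.inl) Sig.inr) ≫ copairApp φ k Y = copairApp φ k X ≫ M.map f
    rw [copairApp, ← T.map_comp_assoc, interp_naturality, T.map_comp_assoc, φ.naturality_assoc,
      Monad.mu_naturality, copairApp, Category.assoc, Category.assoc]
  app_η X := congrArg (fun t => Sig.inl ≫ t) (unit_copairApp φ k X)
  app_μ X := by
    change (T.map (addConstSub T K X) ≫ T.μ.app (Sig.sum X K)) ≫ copairApp φ k X =
      (T.map (Sig.desc (copairApp φ k X ≫ Sig.inl) Sig.inr) ≫ copairApp φ k (M.obj X)) ≫ M.μ.app X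
    have h : addConstSub T K X ≫ copairApp φ k X =
        Sig.desc (copairApp φ k X ≫ Sig.inl) Sig.inr ≫ interp k (M.obj X) ≫ M.μ.app X := by
      refine Sig.sum_ext ?_ ?_
      · change copairApp φ k X = copairApp φ k X ≫ M.η.app (M.obj X) ≫ M.μ.app X
        rw [M.left_unit]
        rfl
      · change Sig.inr ≫ T.η.app (Sig.sum X K) ≫ copairApp φ k X = k.app (M.obj X) ≫ M.μ.app X
        -- The constants at `M X` are those at `X` pushed along the unit of `M`; multiplication then
        -- undoes this by the right unit law.
        have h := congrArg (fun t => t ≫ M.μ.app X) (const_naturality k (M.η.app X))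
        rw [unit_copairApp]
        refine Eq.trans ?_ h
        refine Eq.trans ?_ (congrArg (fun t => k.app X ≫ t) (M.right_unit X)).symm
        rfl
    have hl : T.μ.app (Sig.sum X K) ≫ copairApp φ k X =
        T.map (copairApp φ k X) ≫ φ.app (M.obj X) ≫ M.μ.app X := by
      rw [copairApp, ← Monad.mu_naturality_assoc, φ.app_μ_assoc, T.map_comp_assoc,
        T.map_comp_assoc, φ.naturality_assoc (M.μ.app X), M.assoc]
      rfl
    have hr : copairApp φ k (M.obj X) ≫ M.μ.app X =
        T.map (interp k (M.obj X) ≫ M.μ.app X) ≫ φ.app (M.obj X) ≫ M.μ.app X := by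
      rw [copairApp, T.map_comp_assoc, φ.naturality_assoc (M.μ.app X), M.assoc]
      simp only [Category.assoc]
      rfl
    rw [Category.assoc, hl, Category.assoc, hr, ← T.map_comp_assoc, h, ← T.map_comp_assoc]

/-- The analogue of `alg_factor` for monad morphisms: compatibility with the multiplications,
restricted along `Sig.inl` and precomposed with the unit, expresses `ψ` through its restrictions to
`T` and to the constants. -/
theorem hom_eq_copairApp (ψ : addConst T K ⟶ M) (hi : inl T K ≫ ψ = φ)
    (hk : inr T K ≫ ψ.toNatTrans = k) (X : Sig.{u}) : ψ.app X = copairApp φ k X := by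
  have hi' : T.map Sig.inl ≫ ψ.app (M.obj X) = φ.app (M.obj X) :=
    congrArg (fun t : T ⟶ M => t.app (M.obj X)) hi
  have hk' : Sig.inr ≫ T.η.app (Sig.sum X K) ≫ ψ.app X = k.app X :=
    congrArg (fun t : constF K ⟶ M.toFunctor => t.app X) hk
  have hη : Sig.inl ≫ T.η.app (Sig.sum X K) ≫ ψ.app X = M.η.app X := ψ.app_η X
  have hμ : T.map (addConstSub T K X) ≫ T.μ.app (Sig.sum X K) ≫ ψ.app X =
      T.map (Sig.desc (ψ.app X ≫ Sig.inl) Sig.inr) ≫ ψ.app (M.obj X) ≫ M.μ.app X := ψ.app_μ X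
  -- The components are made into variables so that their sources can be restated as values of `T`,
  -- which lets rewriting with the laws of `T` apply.
  generalize ψ.app X = p at *
  generalize ψ.app (M.obj X) = p' at *
  change T.obj (Sig.sum X K) ⟶ M.obj X at p
  change T.obj (Sig.sum (M.obj X) K) ⟶ M.obj (M.obj X) at p'
  have hp : T.η.app (Sig.sum X K) ≫ p = interp k X := Sig.sum_ext hη hk'
  have e := congrArg (fun t => T.map (T.η.app (Sig.sum X K)) ≫ T.map Sig.inl ≫ t) hμ
  have e1 : (Sig.inl : T.obj (Sig.sum X K) ⟶ Sig.sum _ K) ≫ addConstSub T K X = 𝟙 _ := rfl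
  have e2 : (Sig.inl : T.obj (Sig.sum X K) ⟶ Sig.sum _ K) ≫
    Sig.desc (p ≫ Sig.inl) Sig.inr = p ≫ Sig.inl := rfl
  have e3 : T.map (T.η.app (Sig.sum X K)) ≫ T.μ.app (Sig.sum X K) ≫ p = p := by
    rw [← Category.assoc, T.right_unit]
    rfl
  have l1 : T.map (Sig.inl : T.obj (Sig.sum X K) ⟶ Sig.sum _ K) ≫ T.map (addConstSub T K X) ≫
      T.μ.app (Sig.sum X K) ≫ p = T.μ.app (Sig.sum X K) ≫ p := by
    rw [← T.map_comp_assoc, e1, T.map_id, Category.id_comp]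
  have l2 : T.map (Sig.inl : T.obj (Sig.sum X K) ⟶ Sig.sum _ K) ≫
      T.map (Sig.desc (p ≫ Sig.inl) Sig.inr) ≫ p' ≫ M.μ.app X =
      T.map p ≫ T.map Sig.inl ≫ p' ≫ M.μ.app X := by
    rw [← T.map_comp_assoc, e2, T.map_comp_assoc]
  have l3 : T.map (T.η.app (Sig.sum X K)) ≫ T.map p = T.map (interp k X) := by
    rw [← hp]
    exact (T.map_comp _ _).symm
  have l4 := congrArg (fun t => t ≫ φ.app (M.obj X) ≫ M.μ.app X) l3
  have l5 := congrArg (fun t => t ≫ M.μ.app X) hi'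
  rw [l1, e3] at e
  replace e := e.trans (congrArg (fun t => T.map (T.η.app (Sig.sum X K)) ≫ t) l2)
  refine e.trans (Eq.trans ?_ l4)
  exact congrArg (fun t => T.map (T.η.app (Sig.sum X K)) ≫ T.map p ≫ t) l5

end Coproduct

variable (T K)

theorem isCoproductConst : IsCoproductConst (inl T K) (inr T K) := by
  intro M φ k
  refine ⟨copair φ k, ⟨?_, ?_⟩, fun ψ h => MonadHom.ext (funext fun X =>
    hom_eq_copairApp φ k ψ h.1 h.2 X)⟩
  · refine MonadHom.ext (funext fun X => ?_)
    change T.map Sig.inl ≫ T.map (interp k X) ≫ φ.app (M.obj X) ≫ M.μ.app X = φ.app X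
    have h : Sig.inl ≫ interp k X = M.η.app X := rfl
    rw [← T.map_comp_assoc, h, φ.naturality_assoc, M.right_unit]
    rfl
  · refine NatTrans.ext (funext fun X => ?_)
    exact congrArg (fun t => Sig.inr ≫ t) (unit_copairApp φ k X)

end addConst

/-! ### Props in single-sorted style

An interpretation of the five operations is studied through the set of all operations of all
types. On it the monoidal product is a total operation, strictly associative and unital. -/

/-- The composition of an interpretation of the five operations. -/
def seqOp {A : Sig.{u}} (o : SSM.obj A ⟶ A) {n k m : ℕ} (f : A n k) (g : A k m) : A n m :=
  o n m (Sum.inl (.mk f g))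

/-- The monoidal product of an interpretation of the five operations. -/
def parOp {A : Sig.{u}} (o : SSM.obj A ⟶ A) {a b c d : ℕ} (f : A a b) (g : A c d) :
    A (a + c) (b + d) :=
  o _ _ (Sum.inr (Sum.inr (Sum.inl (.mk f g))))

/-- Operations of a signature with an interpretation of the five prop operations, of all types. -/
structure Op {A : Sig.{u}} (o : SSM.obj A ⟶ A) : Type u where
  dom : ℕ
  cod : ℕ
  arr : A dom cod

namespace Op

variable {A : Sig.{u}} {o : SSM.obj A ⟶ A}

variable (o) in
/-- An operation of given type. -/
def of {n m : ℕ} (f : A n m) : Op o := ⟨n, m, f⟩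

@[simp] theorem dom_of {n m : ℕ} (f : A n m) : (of o f).dom = n := rfl
@[simp] theorem cod_of {n m : ℕ} (f : A n m) : (of o f).cod = m := rfl

theorem of_injective {n m : ℕ} {f g : A n m} (h : of o f = of o g) : f = g := by
  simpa [of] using h

/-- This is the reason for working in `Op`: transport along equalities of arities and coarities is
invisible there. -/
theorem of_recast {n m n' m' : ℕ} (hn : n = n') (hm : m = m') (f : A n m) :
    of o (Sig.recast hn hm f) = of o f := by
  subst hn hm; rfl

instance : One (Op o) := ⟨of o (o 0 0 (Sum.inr (Sum.inr (Sum.inr (Sum.inl .pt)))))⟩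

instance : Mul (Op o) :=
  ⟨fun f g => of o (parOp o f.arr g.arr)⟩

/-- Sequential composition, with the value `f` if the types do not match. -/
def cmp (f g : Op o) : Op o :=
  if h : f.cod = g.dom then
    of o (seqOp o f.arr (Sig.recast h.symm rfl g.arr))
  else f

infixl:65 " ⊚ " => cmp

variable (o) in
/-- The identity on `1`. -/
def one : Op o := of o (o 1 1 (Sum.inr (Sum.inl .pt)))

variable (o) in
/-- The basic symmetry. -/
def sw : Op o := of o (o 2 2 (Sum.inr (Sum.inr (Sum.inr (Sum.inr .pt)))))

variable (o) in
/-- The identity on `n`. -/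
def idn : ℕ → Op o
  | 0 => 1
  | n + 1 => idn n * one o

variable (o) in
/-- The symmetry of `1` past `n`. -/
def sigL : ℕ → Op o
  | 0 => one o
  | n + 1 => (sigL n * one o) ⊚ (idn o n * sw o)

variable (o) in
/-- The symmetry of `n` past `1`. -/
def sigR : ℕ → Op o
  | 0 => one o
  | n + 1 => (idn o n * sw o) ⊚ (sigR n * one o)

variable (o) in
/-- The symmetry of `n` past `m`. -/
def braid (n : ℕ) : ℕ → Op o
  | 0 => idn o n
  | m + 1 => (braid n m * one o) ⊚ (idn o m * sigR o n)

@[simp] theorem dom_one' : (one o).dom = 1 := rfl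
@[simp] theorem cod_one' : (one o).cod = 1 := rfl
@[simp] theorem dom_sw : (sw o).dom = 2 := rfl
@[simp] theorem cod_sw : (sw o).cod = 2 := rfl
@[simp] theorem dom_mul (f g : Op o) : (f * g).dom = f.dom + g.dom := rfl
@[simp] theorem cod_mul (f g : Op o) : (f * g).cod = f.cod + g.cod := rfl

theorem of_cmp {n k m : ℕ} (f : A n k) (g : A k m) :
    of o (seqOp o f g) = of o f ⊚ of o g := by
  unfold cmp; rw [dif_pos (show (of o f).cod = (of o g).dom from rfl)]; rfl

@[simp] theorem dom_cmp (f g : Op o) : (f ⊚ g).dom = f.dom := by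
  unfold cmp; split <;> rfl

theorem cod_cmp (f g : Op o) (h : f.cod = g.dom) : (f ⊚ g).cod = g.cod := by
  unfold cmp; rw [dif_pos h]; rfl

@[simp] theorem dom_idn (n : ℕ) : (idn o n).dom = n := by
  induction n with
  | zero => rfl
  | succ n ih => simp [idn, ih]

@[simp] theorem cod_idn (n : ℕ) : (idn o n).cod = n := by
  induction n with
  | zero => rfl
  | succ n ih => simp [idn, ih]

@[simp] theorem dom_sigL (n : ℕ) : (sigL o n).dom = n + 1 := by
  induction n with
  | zero => rfl
  | succ n ih => simp [sigL, ih]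

@[simp] theorem cod_sigL (n : ℕ) : (sigL o n).cod = n + 1 := by
  induction n with
  | zero => rfl
  | succ n ih => rw [sigL, cod_cmp] <;> simp [ih]

@[simp] theorem dom_sigR (n : ℕ) : (sigR o n).dom = n + 1 := by
  induction n with
  | zero => rfl
  | succ n ih => simp [sigR]

@[simp] theorem cod_sigR (n : ℕ) : (sigR o n).cod = n + 1 := by
  induction n with
  | zero => rfl
  | succ n ih => rw [sigR, cod_cmp] <;> simp [ih]

@[simp] theorem dom_braid (n m : ℕ) : (braid o n m).dom = n + m := by
  induction m with
  | zero => simp [braid]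
  | succ m ih => simp [braid, ih]; omega

@[simp] theorem cod_braid (n m : ℕ) : (braid o n m).cod = m + n := by
  induction m with
  | zero => simp [braid]
  | succ m ih => rw [braid, cod_cmp] <;> simp [ih] <;> omega

end Op

open Op

/-- The equations of symmetric strict monoidal categories. -/
structure SMLaws {A : Sig.{u}} (o : SSM.obj A ⟶ A) : Prop where
  tens_assoc : ∀ f g h : Op o, f * g * h = f * (g * h)
  unit_tens : ∀ f : Op o, 1 * f = f
  tens_unit : ∀ f : Op o, f * 1 = f
  symm : sw o ⊚ sw o = idn o 2
  interchange : ∀ f g h i : Op o, f.cod = g.dom → h.cod = i.dom →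
    (f ⊚ g) * (h ⊚ i) = (f * h) ⊚ (g * i)
  comp_assoc : ∀ f g h : Op o, f.cod = g.dom → g.cod = h.dom → f ⊚ g ⊚ h = f ⊚ (g ⊚ h)
  comp_id : ∀ f : Op o, f ⊚ idn o f.cod = f
  id_comp : ∀ f : Op o, idn o f.dom ⊚ f = f
  sigL_natural : ∀ f : Op o, sigL o f.dom ⊚ (f * one o) = (one o * f) ⊚ sigL o f.cod
  sigR_natural : ∀ f : Op o, sigR o f.dom ⊚ (one o * f) = (f * one o) ⊚ sigR o f.cod

/-! ### Hexagons, naturality and involutivity of the derived symmetries -/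

namespace SMLaws

variable {A : Sig.{u}} {o : SSM.obj A ⟶ A} (H : SMLaws o)
include H

theorem one_eq : one o = idn o 1 := (H.unit_tens _).symm

theorem idn_add (n m : ℕ) : idn o (n + m) = idn o n * idn o m := by
  induction m with
  | zero => exact (H.tens_unit _).symm
  | succ m ih => rw [← Nat.add_assoc, idn, ih, H.tens_assoc]; rfl

/-- Interchange, with the identity written as its composite with itself. -/
theorem id_mul_cmp (n : ℕ) (f g : Op o) (h : f.cod = g.dom) :
    idn o n * (f ⊚ g) = (idn o n * f) ⊚ (idn o n * g) := by
  have := H.comp_id (idn o n)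
  rw [cod_idn] at this
  rw [← H.interchange _ _ _ _ (by simp) h, this]

theorem cmp_mul_id (n : ℕ) (f g : Op o) (h : f.cod = g.dom) :
    (f ⊚ g) * idn o n = (f * idn o n) ⊚ (g * idn o n) := by
  have := H.comp_id (idn o n)
  rw [cod_idn] at this
  rw [← H.interchange _ _ _ _ h (by simp), this]

/-- Two operations side by side, the first one applied first. -/
theorem mul_eq_left (f g : Op o) (a b : ℕ) (ha : g.dom = a) (hb : f.cod = b) :
    (f * idn o a) ⊚ (idn o b * g) = f * g := by
  subst ha hb
  rw [← H.interchange _ _ _ _ (by simp) (by simp), H.comp_id, H.id_comp]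

/-- Two operations side by side, the second one applied first. -/
theorem mul_eq_right (f g : Op o) (a b : ℕ) (ha : f.dom = a) (hb : g.cod = b) :
    (idn o a * g) ⊚ (f * idn o b) = f * g := by
  subst ha hb
  rw [← H.interchange _ _ _ _ (by simp) (by simp), H.comp_id, H.id_comp]

theorem comp_id' (f : Op o) (n : ℕ) (h : f.cod = n) : f ⊚ idn o n = f := by
  subst h; exact H.comp_id f

theorem id_comp' (f : Op o) (n : ℕ) (h : f.dom = n) : idn o n ⊚ f = f := by
  subst h; exact H.id_comp f

/-- Induction on `m`: the operation slides past the first `m` wires by the inductive hypothesis and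
past the last one by `sigR_natural`. -/
theorem braid_natural_left (f : Op o) (m : ℕ) :
    (f * idn o m) ⊚ braid o f.cod m = braid o f.dom m ⊚ (idn o m * f) := by
  induction m with
  | zero =>
    simp only [braid, idn, H.tens_unit, H.unit_tens, H.comp_id, H.id_comp]
  | succ m ih =>
    have h1 := congrArg (fun t => t * one o) ih
    have h2 := congrArg (fun t => idn o m * t) (H.sigR_natural f)
    simp only [H.one_eq] at h1 h2
    rw [H.cmp_mul_id _ _ _ (by simp), H.cmp_mul_id _ _ _ (by simp)] at h1
    rw [H.id_mul_cmp _ _ _ (by simp; omega), H.id_mul_cmp _ _ _ (by simp)] at h2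
    simp only [braid, H.one_eq, H.idn_add m 1, ← H.tens_assoc] at h1 h2 ⊢
    rw [← H.comp_assoc _ _ _ (by simp) (by simp; omega), h1,
      H.comp_assoc _ _ _ (by simp) (by simp; omega), ← h2,
      H.comp_assoc _ _ _ (by simp; omega) (by simp; omega)]

/-- The first hexagon. The recursion defining `braid` peels one wire off the right block, so
induction on `k` needs only associativity and interchange with identities. -/
theorem braid_add_right (n m k : ℕ) :
    braid o n (m + k) = (braid o n m * idn o k) ⊚ (idn o m * braid o n k) := by
  induction k with
  | zero =>
    simp only [braid, idn, H.tens_unit, Nat.add_zero, ← H.idn_add]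
    rw [H.comp_id' _ _ (by simp)]
  | succ k ih =>
    rw [← Nat.add_assoc, braid, braid, ih, H.id_mul_cmp _ _ _ (by simp; omega)]
    simp only [H.one_eq]
    rw [H.cmp_mul_id _ _ _ (by simp; omega), H.idn_add m k, H.idn_add k 1]
    simp only [H.tens_assoc]
    rw [H.comp_assoc _ _ _ (by simp; omega) (by simp; omega)]

theorem sigR_zero : sigR o 0 = idn o 1 := H.one_eq

theorem sigR_one : sigR o 1 = sw o := by
  have := H.idn_add 1 1
  rw [sigR, sigR, idn, H.unit_tens, H.one_eq, ← this, H.comp_id' _ _ (by simp)]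

/-- For one wire on the left the recursion of `braid` becomes that of `sigL`, because `sigR o 1` is
the basic crossing. -/
theorem braid_one_left (m : ℕ) : braid o 1 m = sigL o m := by
  induction m with
  | zero => exact H.one_eq.symm
  | succ m ih => rw [braid, ih, H.sigR_one, sigL]

/-- The second hexagon for a single wire in the right block; it supplies the inductive step of
`braid_add_left`. -/
theorem sigR_add (n k : ℕ) :
    sigR o (n + k) = (idn o n * sigR o k) ⊚ (sigR o n * idn o k) := by
  induction k with
  | zero =>
    have h := H.idn_add n 1
    have h' : idn o 0 = 1 := rfl
    simp only [H.sigR_zero, h', H.tens_unit, Nat.add_zero, ← h]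
    rw [H.id_comp' _ _ (by simp)]
  | succ k ih =>
    rw [← Nat.add_assoc, sigR, sigR, ih, H.id_mul_cmp _ _ _ (by simp)]
    simp only [H.one_eq]
    rw [H.cmp_mul_id _ _ _ (by simp; omega), H.idn_add n k, H.idn_add k 1]
    simp only [H.tens_assoc]
    rw [H.comp_assoc _ _ _ (by simp) (by simp; omega)]

/-- The second hexagon, against the direction of the recursion. In the inductive step the crossing
of the `n`-block with `m` wires and that of the `k`-block with the last wire occur in the wrong
order; they act on disjoint wires and commute. -/
theorem braid_add_left (n k m : ℕ) :
    braid o (n + k) m = (idn o n * braid o k m) ⊚ (braid o n m * idn o k) := by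
  induction m with
  | zero =>
    have h := H.idn_add n k
    simp only [braid, ← h]
    rw [H.id_comp' _ _ (by simp)]
  | succ m ih =>
    have h : (braid o n m * idn o k * idn o 1) ⊚ (idn o m * idn o n * sigR o k) =
        (idn o n * idn o m * sigR o k) ⊚ (braid o n m * idn o 1 * idn o k) := by
      have h1 := H.mul_eq_left (braid o n m) (sigR o k) _ _ (dom_sigR k) (cod_braid n m)
      have h2 := H.mul_eq_right (braid o n m) (sigR o k) _ _ (dom_braid n m) (cod_sigR k)
      rw [Nat.add_comm k 1, H.idn_add, H.idn_add, ← H.tens_assoc] at h2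
      rw [H.idn_add, H.idn_add, ← H.tens_assoc] at h1
      exact h1.trans h2.symm
    simp only [braid]
    rw [ih, H.sigR_add, H.one_eq, H.cmp_mul_id _ _ _ (by simp; omega),
      H.id_mul_cmp _ _ _ (by simp; omega), H.id_mul_cmp _ _ _ (by simp; omega),
      H.cmp_mul_id _ _ _ (by simp; omega)]
    simp only [← H.tens_assoc]
    -- Four explicit rebracketings isolate the two middle factors so that `h` can exchange them.
    have e1 := H.comp_assoc (idn o n * braid o k m * idn o 1) (braid o n m * idn o k * idn o 1)
      ((idn o m * idn o n * sigR o k) ⊚ (idn o m * sigR o n * idn o k))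
      (by simp; omega) (by simp; omega)
    have e2 := H.comp_assoc (braid o n m * idn o k * idn o 1) (idn o m * idn o n * sigR o k)
      (idn o m * sigR o n * idn o k) (by simp; omega) (by simp; omega)
    have e3 := H.comp_assoc (idn o n * braid o k m * idn o 1) (idn o n * idn o m * sigR o k)
      ((braid o n m * idn o 1 * idn o k) ⊚ (idn o m * sigR o n * idn o k))
      (by simp; omega) (by simp; omega)
    have e4 := H.comp_assoc (idn o n * idn o m * sigR o k) (braid o n m * idn o 1 * idn o k)
      (idn o m * sigR o n * idn o k) (by simp; omega) (by simp; omega)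
    rw [e1, ← e2, h, e4, ← e3]

theorem braid_zero_left (m : ℕ) : braid o 0 m = idn o m := by
  induction m with
  | zero => rfl
  | succ m ih =>
    have h := H.idn_add m 1
    simp only [braid, ih, H.sigR_zero, H.one_eq, ← h]
    rw [H.id_comp' _ _ (by simp)]

/-- Here the induction is on the left block. The second hexagon splits off one wire, past which the
operation slides by `sigL_natural`. -/
theorem braid_natural_right (n : ℕ) (g : Op o) :
    (idn o n * g) ⊚ braid o n g.cod = braid o n g.dom ⊚ (g * idn o n) := by
  induction n with
  | zero =>
    simp only [H.braid_zero_left, idn, H.tens_unit, H.unit_tens, H.comp_id, H.id_comp]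
  | succ n ih =>
    have h1 := congrArg (fun t => t * one o) ih
    have h2 := congrArg (fun t => idn o n * t) (H.sigL_natural g)
    simp only [H.one_eq] at h1 h2
    rw [H.cmp_mul_id _ _ _ (by simp), H.cmp_mul_id _ _ _ (by simp)] at h1
    rw [H.id_mul_cmp _ _ _ (by simp), H.id_mul_cmp _ _ _ (by simp; omega)] at h2
    rw [H.braid_add_left, H.braid_add_left, H.braid_one_left, H.braid_one_left]
    simp only [H.idn_add n 1, ← H.tens_assoc] at h1 h2 ⊢
    rw [← H.comp_assoc _ _ _ (by simp; omega) (by simp; omega), ← h2,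
      H.comp_assoc _ _ _ (by simp; omega) (by simp), h1,
      H.comp_assoc _ _ _ (by simp; omega) (by simp)]

/-- The two recursions are mirror images: the inner composite cancels by induction, leaving two
basic crossings, which cancel by `symm`. -/
theorem sigR_sigL (n : ℕ) : sigR o n ⊚ sigL o n = idn o (n + 1) := by
  induction n with
  | zero => rw [H.sigR_zero, sigL, H.one_eq]; exact H.comp_id' _ _ (by simp)
  | succ n ih =>
    have h1 := congrArg (fun t => t * one o) ih
    have h2 := congrArg (fun t => idn o n * t) H.symm
    simp only [H.one_eq] at h1 h2
    rw [H.cmp_mul_id _ _ _ (by simp), ← H.idn_add] at h1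
    rw [H.id_mul_cmp _ _ _ (by simp), ← H.idn_add] at h2
    rw [sigR, sigL, H.one_eq, H.comp_assoc _ _ _ (by simp) (by simp),
      ← H.comp_assoc (sigR o n * idn o 1) _ _ (by simp) (by simp), h1,
      H.id_comp' _ _ (by simp), h2]

/-- Unfolding one factor by recursion and the other by the second hexagon makes `sigR` and `sigL`
adjacent; once they cancel, the inductive hypothesis applies. -/
theorem braid_symm (n m : ℕ) : braid o n m ⊚ braid o m n = idn o (n + m) := by
  induction m with
  | zero =>
    rw [H.braid_zero_left]
    exact H.comp_id' _ _ (by simp)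
  | succ m ih =>
    have h1 := congrArg (fun t => t * one o) ih
    have h2 := congrArg (fun t => idn o m * t) (H.sigR_sigL n)
    simp only [H.one_eq] at h1 h2
    rw [H.cmp_mul_id _ _ _ (by simp), ← H.idn_add] at h1
    rw [H.id_mul_cmp _ _ _ (by simp), ← H.idn_add] at h2
    rw [braid, H.braid_add_left, H.braid_one_left, H.one_eq,
      H.comp_assoc _ _ _ (by simp; omega) (by simp),
      ← H.comp_assoc (idn o m * sigR o n) _ _ (by simp) (by simp; omega), h2,
      H.id_comp' _ _ (by simp; omega), h1, Nat.add_assoc]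

end SMLaws

/-! ### Algebras of the term monad -/

namespace SSMFree

/-- The interpretation of the five operations in an algebra. -/
def algOps (B : SSMFree.{u}.Algebra) : SSM.obj B.A ⟶ B.A := SSMFree.incl.app B.A ≫ B.a

/-- Applying an operation to terms is applying it to variables and then substituting. Associativity
of the algebra therefore makes its structure map a homomorphism for the five operations. -/
theorem op_a (B : SSMFree.{u}.Algebra) :
    SSMFree.op.app B.A ≫ B.a = SSM.map B.a ≫ algOps B := by
  have h1 : SSMFree.op.app B.A = SSMFree.incl.app (SSMFree.obj B.A) ≫ SSMFree.μ.app B.A := by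
    refine Sig.hom_ext fun n m t => ?_
    rcases t with ⟨⟨⟩⟩ | ⟨⟨⟩⟩ | ⟨⟨⟩⟩ | ⟨⟨⟩⟩ | ⟨⟨⟩⟩ <;> rfl
  rw [h1, Category.assoc, B.assoc]
  exact (SSMFree.incl.naturality_assoc B.a B.a).symm

/-- Uniqueness of evaluation applies by `op_a`; the unit law says that variables receive their own
values. -/
theorem a_eq_eval (B : SSMFree.{u}.Algebra) {n m : ℕ} (t : SMTerm B.A n m) :
    B.a n m t = t.eval (algOps B) (𝟙 B.A) :=
  (SMTerm.eq_eval (algOps B) B.a (op_a B) t).trans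
    (congrArg (fun v : B.A ⟶ B.A => SMTerm.eval (algOps B) v t) B.unit)

/-- The algebra of an interpretation of the five operations. -/
def mkAlg {A : Sig.{u}} (o : SSM.obj A ⟶ A) : SSMFree.{u}.Algebra where
  A := A
  a := fun _ _ t => SMTerm.eval o (𝟙 A) t
  unit := rfl
  assoc := Sig.hom_ext fun n m t => by
    change SMTerm (SMTerm A) n m at t
    induction t with
    | var x => rfl
    | comp s t hs ht => exact congrArg₂ (fun a b => seqOp o a b) hs ht
    | one => rfl
    | tens s t hs ht => exact congrArg₂ (fun a b => parOp o a b) hs ht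
    | unit => rfl
    | sw => rfl

theorem algOps_mkAlg {A : Sig.{u}} (o : SSM.obj A ⟶ A) : algOps (mkAlg o) = o :=
  Sig.hom_ext fun n m t => by
    rcases t with ⟨⟨⟩⟩ | ⟨⟨⟩⟩ | ⟨⟨⟩⟩ | ⟨⟨⟩⟩ | ⟨⟨⟩⟩ <;> rfl

end SSMFree

/-! ### Values of terms in the total space of operations -/

namespace Op

variable {A : Sig.{u}} (o : SSM.obj A ⟶ A)

/-- The value of a term. -/
def ev {n m : ℕ} (t : SMTerm A n m) : Op o := of o (SMTerm.eval o (𝟙 A) t)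

open SMTerm

theorem ev_var {n m : ℕ} (x : A n m) : ev o (var x) = of o x := rfl

theorem ev_comp {n k m : ℕ} (s : SMTerm A n k) (t : SMTerm A k m) :
    ev o (comp s t) = ev o s ⊚ ev o t :=
  of_cmp _ _

theorem ev_tens {a b c d : ℕ} (s : SMTerm A a b) (t : SMTerm A c d) :
    ev o (tens s t) = ev o s * ev o t := rfl

theorem ev_recast {n m n' m' : ℕ} (hn : n = n') (hm : m = m') (t : SMTerm A n m) :
    ev o (Sig.recast (X := SMTerm A) hn hm t) = ev o t := by
  subst hn hm; rfl

theorem ev_idn (n : ℕ) : ev o (SMTerm.idn n) = Op.idn o n := by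
  induction n with
  | zero => rfl
  | succ n ih => exact congrArg (fun t => t * Op.one o) ih

theorem ev_sigL (n : ℕ) : ev o (SMTerm.sigL n) = Op.sigL o n := by
  induction n with
  | zero => rfl
  | succ n ih => rw [SMTerm.sigL, ev_comp, ev_tens, ev_tens, ih, ev_idn]; rfl

theorem ev_sigR (n : ℕ) : ev o (SMTerm.sigR n) = Op.sigR o n := by
  induction n with
  | zero => rfl
  | succ n ih => rw [SMTerm.sigR, ev_comp, ev_tens, ev_tens, ih, ev_idn]; rfl

end Op

/-- Moves satisfaction into `Op`, where the transports in the associativity, unit and sliding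
equations vanish. -/
theorem sat_iff_ev (E : MonadEqs SSMFree.{u}) (B : SSMFree.{u}.Algebra) :
    E.Sat B ↔ ∀ n m x, Op.ev (SSMFree.algOps B) (E.l.app B.A n m x) =
      Op.ev (SSMFree.algOps B) (E.r.app B.A n m x) := by
  constructor
  · intro h n m x
    have h1 := congrFun (congrFun (congrFun h n) m) x
    have h2 := (SSMFree.a_eq_eval B (E.l.app B.A n m x)).symm.trans
      (h1.trans (SSMFree.a_eq_eval B (E.r.app B.A n m x)))
    exact congrArg (Op.of _) h2
  · intro h
    refine Sig.hom_ext fun n m x => ?_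
    exact (SSMFree.a_eq_eval B (E.l.app B.A n m x)).trans
      ((Op.of_injective (h n m x)).trans (SSMFree.a_eq_eval B (E.r.app B.A n m x)).symm)

open Op in
/-- An algebra satisfies the equations of symmetric monoidal categories precisely if its
operations do. -/
theorem sat_EqSM_iff (B : SSMFree.{u}.Algebra) : EqSM.Sat B ↔ SMLaws (SSMFree.algOps B) := by
  -- The nested union splits into its ten families, which then match the fields of `SMLaws` in
  -- order.
  simp only [EqSM, MonadEqs.sat_union]
  simp only [sat_iff_ev]
  generalize SSMFree.algOps B = o
  constructor
  · rintro ⟨h1, h2, h3, h4, h5, h6, h7, h8, h9, h10⟩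
    constructor
    · rintro ⟨_, _, f⟩ ⟨_, _, g⟩ ⟨_, _, h⟩
      exact (h1 _ _ (.mk (.mk f g) h)).trans (ev_recast o _ _ _)
    · rintro ⟨_, _, f⟩
      exact (ev_recast o _ _ _).symm.trans (h2 _ _ f)
    · rintro ⟨_, _, f⟩
      exact h3 _ _ f
    · have := h4 _ _ .pt
      exact (ev_comp o _ _).symm.trans (this.trans (ev_idn o 2))
    · rintro ⟨_, _, f⟩ ⟨_, _, g⟩ ⟨_, _, h⟩ ⟨_, _, i⟩ hfg hhi
      dsimp at hfg hhi
      subst hfg hhi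
      have := h5 _ _ (.mk (.mk f g) (.mk h i))
      simp only [SMEq.interchange, ev_tens, ev_comp, ev_var] at this
      exact this
    · rintro ⟨_, _, f⟩ ⟨_, _, g⟩ ⟨_, _, h⟩ hfg hgh
      dsimp at hfg hgh
      subst hfg hgh
      have := h6 _ _ (.mk (.mk f g) h)
      simp only [SMEq.compAssoc, ev_comp, ev_var] at this
      exact this
    · rintro ⟨_, _, f⟩
      have := h7 _ _ f
      simp only [SMEq.compId, ev_comp, ev_var, ev_idn] at this
      exact this
    · rintro ⟨_, _, f⟩
      have := h8 _ _ f
      simp only [SMEq.idComp, ev_comp, ev_var, ev_idn] at this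
      exact this
    · rintro ⟨_, _, f⟩
      have := h9 _ _ (.mk f)
      simp only [SMEq.sigmaLeft, plusOneDesc, ev_recast, ev_comp, ev_tens, ev_var, ev_sigL] at this
      exact this
    · rintro ⟨_, _, f⟩
      have := h10 _ _ (.mk f)
      simp only [SMEq.sigmaRight, plusOneDesc, ev_recast, ev_comp, ev_tens, ev_var, ev_sigR] at this
      exact this
  · intro H
    refine ⟨?_, ?_, ?_, ?_, ?_, ?_, ?_, ?_, ?_, ?_⟩
    · rintro _ _ ⟨⟨f, g⟩, h⟩
      exact (H.tens_assoc (of o f) (of o g) (of o h)).trans (ev_recast o _ _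
        (SMTerm.tens (.var f) (SMTerm.tens (.var g) (.var h)))).symm
    · intro n m f
      exact (ev_recast o _ _ _).trans (H.unit_tens (of o f))
    · intro n m f
      exact H.tens_unit (of o f)
    · rintro _ _ ⟨⟩
      exact (ev_comp o _ _).trans (H.symm.trans (ev_idn o 2).symm)
    · rintro _ _ ⟨⟨f, g⟩, ⟨h, i⟩⟩
      simp only [SMEq.interchange, ev_tens, ev_comp, ev_var]
      exact H.interchange _ _ _ _ rfl rfl
    · rintro _ _ ⟨⟨f, g⟩, h⟩
      simp only [SMEq.compAssoc, ev_comp, ev_var]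
      exact H.comp_assoc _ _ _ rfl rfl
    · intro n m f
      simp only [SMEq.compId, ev_comp, ev_idn]
      exact H.comp_id (of o f)
    · intro n m f
      simp only [SMEq.idComp, ev_comp, ev_idn]
      exact H.id_comp (of o f)
    · rintro _ _ ⟨f⟩
      simp only [SMEq.sigmaLeft, plusOneDesc, ev_recast, ev_comp, ev_tens, ev_var, ev_sigL]
      exact H.sigL_natural (of o f)
    · rintro _ _ ⟨f⟩
      simp only [SMEq.sigmaRight, plusOneDesc, ev_recast, ev_comp, ev_tens, ev_var, ev_sigR]
      exact H.sigR_natural (of o f)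

/-! ### From operations to props -/

/-- An operation as an operation of given type. -/
def Op.toArr {A : Sig.{u}} {o : SSM.obj A ⟶ A} (f : Op o) {n m : ℕ} (hn : f.dom = n)
    (hm : f.cod = m) : A n m :=
  Sig.recast hn hm f.arr

theorem Op.of_toArr {A : Sig.{u}} {o : SSM.obj A ⟶ A} (f : Op o) {n m : ℕ} (hn : f.dom = n)
    (hm : f.cod = m) : Op.of o (f.toArr hn hm) = f :=
  Op.of_recast hn hm f.arr

/-- The objects of the prop of an interpretation of the operations which satisfies the equations. -/
def LawObj {A : Sig.{u}} {o : SSM.obj A ⟶ A} (_ : SMLaws o) : Type := Wires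

namespace LawObj

variable {A : Sig.{u}} {o : SSM.obj A ⟶ A} (H : SMLaws o)

/-- A natural number as an object. -/
def of (n : ℕ) : LawObj H := n

variable {H}

/-- An object as a natural number. -/
def len (X : LawObj H) : ℕ := X

/-- Construction of an arrow from its underlying operation. -/
abbrev mkHom (X Y : LawObj H) (f : Op o) (hX : f.dom = X.len) (hY : f.cod = Y.len) :
    A X.len Y.len :=
  f.toArr hX hY

instance : CategoryStruct.{u} (LawObj H) where
  Hom X Y := A X.len Y.len
  id X := mkHom X X (Op.idn o X.len) (Op.dom_idn _) (Op.cod_idn _)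
  comp f g := seqOp o f g

/-- The operation of an arrow. -/
def op {X Y : LawObj H} (f : X ⟶ Y) : Op o := Op.of o f

theorem hom_ext {X Y : LawObj H} {f g : X ⟶ Y} (h : op f = op g) : f = g := Op.of_injective h

theorem op_id (X : LawObj H) : op (𝟙 X) = Op.idn o X.len := Op.of_toArr _ _ _

theorem op_comp {X Y Z : LawObj H} (f : X ⟶ Y) (g : Y ⟶ Z) : op (f ≫ g) = op f ⊚ op g :=
  Op.of_cmp _ _

instance : Category.{u} (LawObj H) where
  id_comp f := hom_ext (by rw [op_comp, op_id]; exact H.id_comp (op f))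
  comp_id f := hom_ext (by rw [op_comp, op_id]; exact H.comp_id (op f))
  assoc f g h := hom_ext (by simp only [op_comp]; exact H.comp_assoc _ _ _ rfl rfl)

/-- The monoidal product of objects. -/
def add (X Y : LawObj H) : LawObj H := of H (X.len + Y.len)

theorem add_assoc (X Y Z : LawObj H) : add (add X Y) Z = add X (add Y Z) :=
  Nat.add_assoc X.len Y.len Z.len

theorem zero_add (X : LawObj H) : add (of H 0) X = X := Nat.zero_add X.len

theorem add_zero (X : LawObj H) : add X (of H 0) = X := Nat.add_zero X.len

/-- The monoidal product of arrows. -/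
def par {X Y X' Y' : LawObj H} (f : X ⟶ Y) (g : X' ⟶ Y') : add X X' ⟶ add Y Y' :=
  parOp o f g

theorem op_par {X Y X' Y' : LawObj H} (f : X ⟶ Y) (g : X' ⟶ Y') : op (par f g) = op f * op g :=
  rfl

theorem par_id (X Y : LawObj H) : par (𝟙 X) (𝟙 Y) = 𝟙 (add X Y) :=
  hom_ext (by rw [op_par, op_id, op_id, op_id]; exact (H.idn_add _ _).symm)

theorem par_comp {X Y Z X' Y' Z' : LawObj H} (f : X ⟶ Y) (f' : X' ⟶ Y') (g : Y ⟶ Z)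
    (g' : Y' ⟶ Z') : par f f' ≫ par g g' = par (f ≫ g) (f' ≫ g') :=
  hom_ext (by
    simp only [op_comp, op_par]; exact (H.interchange _ _ _ _ rfl rfl).symm)

theorem par_eqToHom {X Y X' Y' : LawObj H} (h : X = Y) (h' : X' = Y') :
    par (eqToHom h) (eqToHom h') = eqToHom (by rw [h, h']) := by
  subst h h'; exact par_id _ _

/-- The strict structure isomorphisms are `eqToHom`s, so this and its companion erase them from
every coherence condition. -/
theorem op_comp_eqToHom {X Y Z : LawObj H} (f : X ⟶ Y) (h : Y = Z) :
    op (f ≫ eqToHom h) = op f := by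
  subst h; rw [eqToHom_refl, Category.comp_id]

theorem op_eqToHom_comp {X Y Z : LawObj H} (h : X = Y) (f : Y ⟶ Z) :
    op (eqToHom h ≫ f) = op f := by
  subst h; rw [eqToHom_refl, Category.id_comp]

instance : MonoidalCategoryStruct.{u} (LawObj H) where
  tensorObj := add
  tensorUnit := of H 0
  tensorHom f g := par f g
  whiskerLeft X _ _ f := par (𝟙 X) f
  whiskerRight f X := par f (𝟙 X)
  associator X Y Z := eqToIso (add_assoc X Y Z)
  leftUnitor X := eqToIso (zero_add X)
  rightUnitor X := eqToIso (add_zero X)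

/-- Naturality of the structure isomorphisms is, after erasing `eqToHom`, one of the strict laws;
the pentagon and triangle compare composites of `eqToHom`s. -/
instance : MonoidalCategory.{u} (LawObj H) :=
  MonoidalCategory.ofTensorHom
    (id_tensorHom_id := par_id)
    (id_tensorHom := fun _ _ _ _ => rfl)
    (tensorHom_id := fun _ _ => rfl)
    (tensorHom_comp_tensorHom := par_comp)
    (associator_naturality := fun f g h => hom_ext
      ((op_comp_eqToHom (par (par f g) h) (add_assoc _ _ _)).trans
        ((H.tens_assoc (op f) (op g) (op h)).trans
          (op_eqToHom_comp (add_assoc _ _ _) (par f (par g h))).symm)))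
    (leftUnitor_naturality := fun f => hom_ext
      ((op_comp_eqToHom (par (𝟙 (of H 0)) f) (zero_add _)).trans (Eq.trans
        ((congrArg (fun t => t * op f) (op_id (of H 0))).trans (H.unit_tens (op f)))
        (op_eqToHom_comp (zero_add _) f).symm)))
    (rightUnitor_naturality := fun f => hom_ext
      ((op_comp_eqToHom (par f (𝟙 (of H 0))) (add_zero _)).trans (Eq.trans
        ((congrArg (fun t => op f * t) (op_id (of H 0))).trans (H.tens_unit (op f)))
        (op_eqToHom_comp (add_zero _) f).symm)))
    (pentagon := fun W X Y Z => by
      change par (eqToHom (add_assoc W X Y)) (eqToHom (Eq.refl Z)) ≫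
        eqToHom (add_assoc W (add X Y) Z) ≫ par (eqToHom (Eq.refl W)) (eqToHom (add_assoc X Y Z)) =
        eqToHom (add_assoc (add W X) Y Z) ≫ eqToHom (add_assoc W X (add Y Z))
      simp only [par_eqToHom, eqToHom_trans])
    (triangle := fun X Y => by
      change eqToHom (add_assoc X (of H 0) Y) ≫ par (eqToHom (Eq.refl X)) (eqToHom (zero_add Y)) =
        par (eqToHom (add_zero X)) (eqToHom (Eq.refl Y))
      simp only [par_eqToHom, eqToHom_trans])

instance : StrictMonoidal (LawObj H) where
  tensor_assoc := add_assoc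
  unit_tensor := zero_add
  tensor_unit := add_zero
  associator_eq _ _ _ := rfl
  leftUnitor_eq _ := rfl
  rightUnitor_eq _ := rfl

/-- The braiding. -/
def swap (X Y : LawObj H) : X ⊗ Y ⟶ Y ⊗ X :=
  mkHom (add X Y) (add Y X) (Op.braid o X.len Y.len) (Op.dom_braid _ _) (Op.cod_braid _ _)

theorem op_swap (X Y : LawObj H) : op (swap X Y) = Op.braid o X.len Y.len := Op.of_toArr _ _ _

theorem swap_swap (X Y : LawObj H) : swap X Y ≫ swap Y X = 𝟙 (X ⊗ Y) :=
  hom_ext (by rw [op_comp, op_swap, op_swap, op_id]; exact H.braid_symm _ _)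

theorem op_whiskerLeft {X Y : LawObj H} (Z : LawObj H) (f : X ⟶ Y) :
    op (Z ◁ f) = Op.idn o Z.len * op f :=
  congrArg (fun t => t * op f) (op_id Z)

theorem op_whiskerRight {X Y : LawObj H} (f : X ⟶ Y) (Z : LawObj H) :
    op (f ▷ Z) = op f * Op.idn o Z.len :=
  congrArg (fun t => op f * t) (op_id Z)

theorem op_associator_comp {X Y Z W : LawObj H} (f : X ⊗ (Y ⊗ Z) ⟶ W) :
    op ((α_ X Y Z).hom ≫ f) = op f :=
  op_eqToHom_comp (add_assoc X Y Z) f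

theorem op_comp_associator {X Y Z W : LawObj H} (f : W ⟶ (X ⊗ Y) ⊗ Z) :
    op (f ≫ (α_ X Y Z).hom) = op f :=
  op_comp_eqToHom f (add_assoc X Y Z)

theorem op_associator_inv_comp {X Y Z W : LawObj H} (f : (X ⊗ Y) ⊗ Z ⟶ W) :
    op ((α_ X Y Z).inv ≫ f) = op f :=
  op_eqToHom_comp (add_assoc X Y Z).symm f

theorem op_comp_associator_inv {X Y Z W : LawObj H} (f : W ⟶ X ⊗ (Y ⊗ Z)) :
    op (f ≫ (α_ X Y Z).inv) = op f :=
  op_comp_eqToHom f (add_assoc X Y Z).symm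

/-- With the associators erased, the axioms are exactly the naturality, hexagon and involutivity
statements proved for `braid`. -/
instance : SymmetricCategory.{u} (LawObj H) where
  braiding X Y := ⟨swap X Y, swap Y X, swap_swap X Y, swap_swap Y X⟩
  braiding_naturality_right X Y Z f := hom_ext (by
    simp only [op_comp, op_whiskerLeft, op_whiskerRight, op_swap]
    exact H.braid_natural_right X.len (op f))
  braiding_naturality_left f Z := hom_ext (by
    simp only [op_comp, op_whiskerLeft, op_whiskerRight, op_swap]
    exact H.braid_natural_left (op f) Z.len)
  hexagon_forward X Y Z := hom_ext (by
    rw [op_associator_comp, op_comp_associator, op_comp, op_associator_comp, op_whiskerLeft,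
      op_whiskerRight, op_swap, op_swap, op_swap]
    exact H.braid_add_right X.len Y.len Z.len)
  hexagon_reverse X Y Z := hom_ext (by
    rw [op_associator_inv_comp, op_comp_associator_inv, op_comp, op_associator_inv_comp,
      op_whiskerLeft, op_whiskerRight, op_swap, op_swap, op_swap]
    exact H.braid_add_left X.len Y.len Z.len)
  symmetry X Y := swap_swap X Y

end LawObj

/-- The prop of an interpretation of the operations which satisfies the equations. -/
def SMLaws.toPROP {A : Sig.{u}} {o : SSM.obj A ⟶ A} (H : SMLaws o) : PROP.{u} where
  cat := inferInstanceAs (Category (LawObj H))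
  mon := inferInstanceAs (MonoidalCategory (LawObj H))
  sym := inferInstanceAs (SymmetricCategory (LawObj H))
  strict := inferInstanceAs (StrictMonoidal (LawObj H))
  unit_eq := rfl
  tensor_eq _ _ := rfl

/-! ### From props to operations -/

namespace PROP

instance (P : PROP.{u}) : StrictMonoidal P.Obj := P.strict

variable {P : PROP.{u}}

/-- An object as a natural number. -/
def len (X : P.Obj) : ℕ := X

/-- The operation of an arrow. -/
def op {X Y : P.Obj} (f : X ⟶ Y) : Op P.ops := Op.of (A := P.sig) P.ops (n := len X) (m := len Y) f

@[simp] theorem dom_op {X Y : P.Obj} (f : X ⟶ Y) : (op f).dom = len X := rfl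
@[simp] theorem cod_op {X Y : P.Obj} (f : X ⟶ Y) : (op f).cod = len Y := rfl

theorem op_comp {X Y Z : P.Obj} (f : X ⟶ Y) (g : Y ⟶ Z) : op (f ≫ g) = op f ⊚ op g :=
  Op.of_cmp (A := P.sig) (o := P.ops) (n := len X) (k := len Y) (m := len Z) f g

theorem op_comp_eqToHom {X Y Z : P.Obj} (f : X ⟶ Y) (h : Y = Z) :
    op (f ≫ eqToHom h) = op f := by
  subst h; rw [eqToHom_refl, Category.comp_id]

theorem op_eqToHom_comp {X Y Z : P.Obj} (h : X = Y) (f : Y ⟶ Z) :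
    op (eqToHom h ≫ f) = op f := by
  subst h; rw [eqToHom_refl, Category.id_comp]

theorem op_conj {X Y X' Y' : P.Obj} (h : X' = X) (f : X ⟶ Y) (h' : Y = Y') :
    op (eqToHom h ≫ f ≫ eqToHom h') = op f := by
  rw [op_eqToHom_comp, op_comp_eqToHom]

/-- The arrow operation `tens` differs from the categorical tensor only by conjugation with
`eqToHom`, which `op` ignores. -/
theorem op_tensorHom {X Y X' Y' : P.Obj} (f : X ⟶ Y) (g : X' ⟶ Y') :
    op (f ⊗ₘ g) = op f * op g :=
  (op_conj (P.of_add (len X) (len X')) (f ⊗ₘ g) (P.of_add (len Y) (len Y')).symm).symm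

theorem len_tensor (X Y : P.Obj) : len (X ⊗ Y) = len X + len Y := P.tensor_eq X Y

theorem op_id (X : P.Obj) : op (𝟙 X) = Op.idn P.ops (len X) := by
  -- Objects are numbers, so induction applies: `n + 1` is the tensor of `n` and `1`, and the
  -- identities on `0` and `1` are among the five operations.
  suffices h : ∀ n : ℕ, op (𝟙 (P.of n)) = Op.idn P.ops n from h X
  intro n
  induction n with
  | zero => rfl
  | succ n ih =>
    rw [P.of_add, ← id_tensorHom_id, op_tensorHom, ih]
    rfl

theorem op_whiskerLeft {X Y : P.Obj} (Z : P.Obj) (f : X ⟶ Y) :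
    op (Z ◁ f) = Op.idn P.ops (len Z) * op f := by
  rw [← id_tensorHom, op_tensorHom, op_id]

theorem op_whiskerRight {X Y : P.Obj} (f : X ⟶ Y) (Z : P.Obj) :
    op (f ▷ Z) = op f * Op.idn P.ops (len Z) := by
  rw [← tensorHom_id, op_tensorHom, op_id]

theorem op_associator_comp {X Y Z W : P.Obj} (f : X ⊗ (Y ⊗ Z) ⟶ W) :
    op ((α_ X Y Z).hom ≫ f) = op f := by
  rw [StrictMonoidal.associator_eq]; exact op_eqToHom_comp (StrictMonoidal.tensor_assoc X Y Z) f

theorem op_comp_associator {X Y Z W : P.Obj} (f : W ⟶ (X ⊗ Y) ⊗ Z) :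
    op (f ≫ (α_ X Y Z).hom) = op f := by
  rw [StrictMonoidal.associator_eq]; exact op_comp_eqToHom f (StrictMonoidal.tensor_assoc X Y Z)

theorem op_associator_inv_comp {X Y Z W : P.Obj} (f : (X ⊗ Y) ⊗ Z ⟶ W) :
    op ((α_ X Y Z).inv ≫ f) = op f := by
  rw [StrictMonoidal.associator_eq]; exact op_eqToHom_comp (StrictMonoidal.tensor_assoc X Y Z).symm f

theorem op_comp_associator_inv {X Y Z W : P.Obj} (f : W ⟶ X ⊗ (Y ⊗ Z)) :
    op (f ≫ (α_ X Y Z).inv) = op f := by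
  rw [StrictMonoidal.associator_eq]; exact op_comp_eqToHom f (StrictMonoidal.tensor_assoc X Y Z).symm

theorem exists_eq_op (f : Op P.ops) : ∃ (n m : ℕ) (f' : P.of n ⟶ P.of m), f = op f' :=
  ⟨f.dom, f.cod, f.arr, rfl⟩

@[simp] theorem len_of (n : ℕ) : len (P.of n) = n := rfl

theorem len_unit : len (𝟙_ P.Obj) = 0 := P.unit_eq

variable (P)

/-- The operation of the braiding. -/
def braidOp (n m : ℕ) : Op P.ops := op (β_ (P.of n) (P.of m)).hom

theorem op_swap (n m : ℕ) : Op.of (A := P.sig) P.ops (P.swap n m) = P.braidOp n m :=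
  op_conj (P.of_add n m) (β_ (P.of n) (P.of m)).hom (P.of_add m n).symm

theorem sw_eq : Op.sw P.ops = P.braidOp 1 1 := P.op_swap 1 1

theorem braidOp_add_right (n m k : ℕ) : P.braidOp n (m + k) =
    (P.braidOp n m * Op.idn P.ops k) ⊚ (Op.idn P.ops m * P.braidOp n k) := by
  have h := congrArg op (BraidedCategory.hexagon_forward (P.of n) (P.of m) (P.of k))
  rw [op_associator_comp, op_comp_associator, op_comp, op_associator_comp, op_whiskerLeft,
      op_whiskerRight, ← P.of_add] at h
  exact h

theorem braidOp_add_left (n m k : ℕ) : P.braidOp (n + m) k =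
    (Op.idn P.ops n * P.braidOp m k) ⊚ (P.braidOp n k * Op.idn P.ops m) := by
  have h := congrArg op (BraidedCategory.hexagon_reverse (P.of n) (P.of m) (P.of k))
  rw [op_associator_inv_comp, op_comp_associator_inv, op_comp, op_associator_inv_comp,
      op_whiskerLeft, op_whiskerRight, ← P.of_add] at h
  exact h

theorem comp_id (f : Op P.ops) : f ⊚ Op.idn P.ops f.cod = f := by
  obtain ⟨n, m, f, rfl⟩ := exists_eq_op f
  rw [cod_op, ← op_id, ← op_comp, Category.comp_id]

theorem id_comp (f : Op P.ops) : Op.idn P.ops f.dom ⊚ f = f := by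
  obtain ⟨n, m, f, rfl⟩ := exists_eq_op f
  rw [dom_op, ← op_id, ← op_comp, Category.id_comp]

/-- This is naturality of the left unitor, whose components are `eqToHom`s by strictness. -/
theorem unit_tens (f : Op P.ops) : 1 * f = f := by
  obtain ⟨n, m, f, rfl⟩ := exists_eq_op f
  have h := congrArg op (leftUnitor_naturality f)
  rw [StrictMonoidal.leftUnitor_eq, StrictMonoidal.leftUnitor_eq] at h
  have h' := (op_comp_eqToHom _ (StrictMonoidal.unit_tensor _)).symm.trans
    (h.trans (op_eqToHom_comp (StrictMonoidal.unit_tensor _) f))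
  rw [op_whiskerLeft, len_unit] at h'
  exact h'

theorem tens_unit (f : Op P.ops) : f * 1 = f := by
  obtain ⟨n, m, f, rfl⟩ := exists_eq_op f
  have h := congrArg op (rightUnitor_naturality f)
  rw [StrictMonoidal.rightUnitor_eq, StrictMonoidal.rightUnitor_eq] at h
  have h' := (op_comp_eqToHom _ (StrictMonoidal.tensor_unit _)).symm.trans
    (h.trans (op_eqToHom_comp (StrictMonoidal.tensor_unit _) f))
  rw [op_whiskerRight, len_unit] at h'
  exact h'

theorem braidOp_zero_right (n : ℕ) : P.braidOp n 0 = Op.idn P.ops n := by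
  have h := congrArg op (braiding_tensorUnit_right (P.of n))
  -- The remaining bare `eqToHom` is written as an identity followed by itself, so that erasing it
  -- leaves an identity.
  rw [StrictMonoidal.rightUnitor_eq, StrictMonoidal.leftUnitor_eq, eqToIso.hom, eqToIso.inv,
    op_comp_eqToHom, ← Category.id_comp (eqToHom _), op_comp_eqToHom, op_id, len_tensor,
    len_unit] at h
  have hu : 𝟙_ P.Obj = P.of 0 := P.unit_eq
  rw [braidOp, ← hu]
  exact h

theorem braidOp_zero_left (n : ℕ) : P.braidOp 0 n = Op.idn P.ops n := by
  have h := congrArg op (braiding_tensorUnit_left (P.of n))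
  rw [StrictMonoidal.rightUnitor_eq, StrictMonoidal.leftUnitor_eq, eqToIso.hom, eqToIso.inv,
    op_eqToHom_comp, ← Category.comp_id (eqToHom _), op_eqToHom_comp, op_id, len_tensor,
    len_unit] at h
  have hu : 𝟙_ P.Obj = P.of 0 := P.unit_eq
  rw [braidOp, ← hu]
  exact h

/-- The hexagon splits one wire off the left block, which is the recursion defining `sigR`; the
crossing of two single wires is `sw`. -/
theorem sigR_eq (n : ℕ) : Op.sigR P.ops n = P.braidOp n 1 := by
  induction n with
  | zero => rw [P.braidOp_zero_left]; exact (P.unit_tens _).symm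
  | succ n ih =>
    rw [P.braidOp_add_left, ← P.sw_eq, ← ih, Op.idn, Op.idn, P.unit_tens]
    rfl

theorem sigL_eq (n : ℕ) : Op.sigL P.ops n = P.braidOp 1 n := by
  induction n with
  | zero => rw [P.braidOp_zero_right]; exact (P.unit_tens _).symm
  | succ n ih =>
    rw [P.braidOp_add_right, ← P.sw_eq, ← ih, Op.idn, Op.idn, P.unit_tens]
    rfl

/-- Each law is a categorical axiom read through `op`; the sliding laws are naturality of the
braiding with the object `1`, by `sigL_eq` and `sigR_eq`. -/
theorem laws : SMLaws P.ops where
  tens_assoc f g h := by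
    obtain ⟨_, _, f, rfl⟩ := exists_eq_op f
    obtain ⟨_, _, g, rfl⟩ := exists_eq_op g
    obtain ⟨_, _, h, rfl⟩ := exists_eq_op h
    have e := congrArg op (associator_naturality f g h)
    rw [op_associator_comp, op_comp_associator] at e
    simpa only [op_tensorHom] using e
  unit_tens := P.unit_tens
  tens_unit := P.tens_unit
  symm := by
    have e := congrArg op (SymmetricCategory.symmetry (P.of 1) (P.of 1))
    rw [op_comp, op_id, len_tensor] at e
    rw [sw_eq]
    exact e
  interchange f g h i hfg hhi := by
    obtain ⟨_, _, f, rfl⟩ := exists_eq_op f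
    obtain ⟨_, _, g, rfl⟩ := exists_eq_op g
    obtain ⟨_, _, h, rfl⟩ := exists_eq_op h
    obtain ⟨_, _, i, rfl⟩ := exists_eq_op i
    simp only [dom_op, cod_op, len_of] at hfg hhi
    subst hfg hhi
    rw [← op_comp, ← op_comp, ← op_tensorHom, ← op_tensorHom, ← op_tensorHom, ← op_comp,
      tensorHom_comp_tensorHom]
  comp_assoc f g h hfg hgh := by
    obtain ⟨_, _, f, rfl⟩ := exists_eq_op f
    obtain ⟨_, _, g, rfl⟩ := exists_eq_op g
    obtain ⟨_, _, h, rfl⟩ := exists_eq_op h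
    simp only [dom_op, cod_op, len_of] at hfg hgh
    subst hfg hgh
    rw [← op_comp, ← op_comp, ← op_comp, ← op_comp, Category.assoc]
  comp_id := P.comp_id
  id_comp := P.id_comp
  sigL_natural f := by
    obtain ⟨_, _, f, rfl⟩ := exists_eq_op f
    have e := congrArg op (BraidedCategory.braiding_naturality_right (P.of 1) f)
    rw [op_comp, op_comp, op_whiskerLeft, op_whiskerRight] at e
    rw [sigL_eq, sigL_eq]
    have h1 : Op.one P.ops = Op.idn P.ops 1 := (P.unit_tens _).symm
    rw [h1]
    exact e.symm
  sigR_natural f := by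
    obtain ⟨_, _, f, rfl⟩ := exists_eq_op f
    have e := congrArg op (BraidedCategory.braiding_naturality_left f (P.of 1))
    rw [op_comp, op_comp, op_whiskerLeft, op_whiskerRight] at e
    rw [sigR_eq, sigR_eq]
    have h1 : Op.one P.ops = Op.idn P.ops 1 := (P.unit_tens _).symm
    rw [h1]
    exact e.symm

/-- The symmetries of a prop are determined by the basic one. -/
theorem op_swap_eq (n m : ℕ) :
    Op.of (A := P.sig) P.ops (P.swap n m) = Op.braid P.ops n m := by
  rw [op_swap]
  induction m with
  | zero => exact P.braidOp_zero_right n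
  | succ m ih =>
    rw [braidOp_add_right, ih, ← sigR_eq, ← P.laws.one_eq]
    rfl

/-! ### Extensionality of props -/

theorem category_ext {C : Type*} {S S' : Category.{u} C}
    (hh : S.Hom = S'.Hom) (hi : HEq S.id S'.id) (hc : HEq (@S.comp) (@S'.comp)) : S = S' := by
  obtain @⟨@⟨⟨Hom⟩, i, c⟩, _, _, _⟩ := S
  obtain @⟨@⟨⟨Hom'⟩, i', c'⟩, _, _, _⟩ := S'
  obtain rfl : Hom = Hom' := hh
  cases hi
  cases hc
  rfl

theorem monoidalStruct_ext {C : Type*} [Category.{u} C] {S S' : MonoidalCategoryStruct C}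
    (ho : ∀ X Y, S.tensorObj X Y = S'.tensorObj X Y) (hu : S.tensorUnit = S'.tensorUnit)
    (hl : ∀ (X : C) {Y Z : C} (f : Y ⟶ Z), HEq (S.whiskerLeft X f) (S'.whiskerLeft X f))
    (hr : ∀ {Y Z : C} (f : Y ⟶ Z) (X : C), HEq (S.whiskerRight f X) (S'.whiskerRight f X))
    (ht : ∀ {X Y X' Y' : C} (f : X ⟶ Y) (f' : X' ⟶ Y'),
      HEq (S.tensorHom f f') (S'.tensorHom f f'))
    (ha : ∀ X Y Z, HEq (S.associator X Y Z) (S'.associator X Y Z))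
    (hlu : ∀ X, HEq (S.leftUnitor X) (S'.leftUnitor X))
    (hru : ∀ X, HEq (S.rightUnitor X) (S'.rightUnitor X)) : S = S' := by
  obtain ⟨o, l, r, t, v, a, lu, ru⟩ := S
  obtain ⟨o', l', r', t', v', a', lu', ru'⟩ := S'
  dsimp at ho hu
  obtain rfl : o = o' := funext fun X => funext fun Y => ho X Y
  subst hu
  obtain rfl : @l = @l' := by funext X Y Z f; exact eq_of_heq (hl X f)
  obtain rfl : @r = @r' := by funext Y Z f X; exact eq_of_heq (hr f X)
  obtain rfl : @t = @t' := by funext X Y X' Y' f f'; exact eq_of_heq (ht f f')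
  obtain rfl : a = a' := by funext X Y Z; exact eq_of_heq (ha X Y Z)
  obtain rfl : lu = lu' := by funext X; exact eq_of_heq (hlu X)
  obtain rfl : ru = ru' := by funext X; exact eq_of_heq (hru X)
  rfl

theorem eqToIso_heq {C : Type*} [Category C] {X Y X' Y' : C} (hX : X = X') (hY : Y = Y')
    (h : X = Y) (h' : X' = Y') : HEq (eqToIso h) (eqToIso h') := by
  subst hX hY; rfl

/-- Strictness leaves no freedom in associators and unitors, and whiskering is tensoring with an
identity, so the tensor and the unit object determine everything. -/
theorem monoidal_ext {C : Type*} [Category.{u} C] {M M' : MonoidalCategory C}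
    (hs : @StrictMonoidal C _ M) (hs' : @StrictMonoidal C _ M')
    (ho : ∀ X Y, M.tensorObj X Y = M'.tensorObj X Y) (hu : M.tensorUnit = M'.tensorUnit)
    (ht : ∀ {X Y X' Y' : C} (f : X ⟶ Y) (f' : X' ⟶ Y'),
      HEq (M.tensorHom f f') (M'.tensorHom f f')) : M = M' := by
  have h : M.toMonoidalCategoryStruct = M'.toMonoidalCategoryStruct := by
    refine monoidalStruct_ext ho hu ?_ ?_ ht ?_ ?_ ?_
    · intro X Y Z f
      have := ht (𝟙 X) f
      rwa [@id_tensorHom C _ M, @id_tensorHom C _ M'] at this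
    · intro Y Z f X
      have := ht f (𝟙 X)
      rwa [@tensorHom_id C _ M, @tensorHom_id C _ M'] at this
    · intro X Y Z
      rw [hs.associator_eq, hs'.associator_eq]
      exact eqToIso_heq (by rw [ho, ho]) (by rw [ho, ho]) _ _
    · intro X
      rw [hs.leftUnitor_eq, hs'.leftUnitor_eq]
      exact eqToIso_heq (by rw [ho, hu]) rfl _ _
    · intro X
      rw [hs.rightUnitor_eq, hs'.rightUnitor_eq]
      exact eqToIso_heq (by rw [ho, hu]) rfl _ _
  cases M
  cases M'
  cases h
  rfl

theorem symmetric_ext {C : Type*} [Category.{u} C] [MonoidalCategory C]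
    {S S' : SymmetricCategory C}
    (h : ∀ X Y : C, (S.braiding X Y).hom = (S'.braiding X Y).hom) : S = S' := by
  obtain @⟨⟨b, _, _, _, _⟩, _⟩ := S
  obtain @⟨⟨b', _, _, _, _⟩, _⟩ := S'
  obtain rfl : b = b' := funext fun X => funext fun Y => Iso.ext (h X Y)
  rfl

/-- Recovers equality of the categorical tensor and braiding from that of `tens` and `swap`, which
are their conjugates by `eqToHom`. -/
theorem heq_of_conj {C : Type*} [Category C] {X Y X' Y' X'' Y'' : C} {h : X = X'} {f : X' ⟶ Y'}
    {h' : Y' = Y} {k : X = X''} {g : X'' ⟶ Y''} {k' : Y'' = Y}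
    (e : eqToHom h ≫ f ≫ eqToHom h' = eqToHom k ≫ g ≫ eqToHom k') : HEq f g := by
  subst h h' k k'
  simpa using e

/-- Props with the same arrows, identities, composition, monoidal product and symmetries are
equal. -/
theorem ext_of {P Q : PROP.{u}} (hA : P.Arr = Q.Arr) (hi : HEq P.ident Q.ident)
    (hc : HEq (@comp P) (@comp Q)) (ht : HEq (@tens P) (@tens Q)) (hs : HEq P.swap Q.swap) :
    P = Q := by
  obtain @⟨cat, mon, sym, strict, cu, ct⟩ := P
  obtain @⟨cat', mon', sym', strict', cu', ct'⟩ := Q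
  -- The layers are identified in order, since each later structure is typed over the earlier ones.
  obtain rfl : cat = cat' := category_ext hA hi hc
  obtain rfl : mon = mon' := monoidal_ext strict strict'
    (fun X Y => (ct X Y).trans (ct' X Y).symm) (cu.trans cu'.symm) (by
      intro X Y X' Y' f f'
      have h := congrFun (congrFun (congrFun (congrFun (congrFun (congrFun
        (eq_of_heq ht) X) Y) X') Y') f) f'
      exact heq_of_conj h)
  obtain rfl : sym = sym' := symmetric_ext (by
    intro X Y
    have h := congrFun (congrFun (eq_of_heq hs) X) Y
    exact eq_of_heq (heq_of_conj h))
  rfl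

end PROP

/-! ### The prop of an algebra -/

namespace Op

variable {A A' : Sig.{u}} {o : SSM.obj A ⟶ A} {o' : SSM.obj A' ⟶ A'} (φ : A ⟶ A')

/-- The action of a map of signatures on operations. -/
def map (f : Op o) : Op o' := of o' (φ f.dom f.cod f.arr)

variable (h : SSM.map φ ≫ o' = o ≫ φ)
include h

theorem map_seqOp {n k m : ℕ} (f : A n k) (g : A k m) :
    φ n m (seqOp o f g) = seqOp o' (φ n k f) (φ k m g) :=
  (congrFun (congrFun (congrFun h n) m) (Sum.inl (.mk f g))).symm

theorem map_parOp {a b c d : ℕ} (f : A a b) (g : A c d) :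
    φ _ _ (parOp o f g) = parOp o' (φ a b f) (φ c d g) :=
  (congrFun (congrFun (congrFun h _) _) (Sum.inr (Sum.inr (Sum.inl (.mk f g))))).symm

theorem map_cmp (f g : Op o) (hfg : f.cod = g.dom) :
    map (o' := o') φ (f ⊚ g) = map φ f ⊚ map φ g := by
  obtain ⟨a, b, f⟩ := f
  obtain ⟨b', c, g⟩ := g
  obtain rfl : b = b' := hfg
  exact (congrArg (map φ) (of_cmp f g).symm).trans
    ((congrArg (of o') (map_seqOp φ h f g)).trans (of_cmp _ _))

theorem map_mul (f g : Op o) : map (o' := o') φ (f * g) = map φ f * map φ g :=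
  congrArg (of o') (map_parOp φ h f.arr g.arr)

theorem map_one : map φ (one o) = one o' :=
  congrArg (of o') (congrFun (congrFun (congrFun h _) _) (Sum.inr (Sum.inl .pt))).symm

theorem map_unit : map φ (1 : Op o) = (1 : Op o') :=
  congrArg (of o')
    (congrFun (congrFun (congrFun h _) _) (Sum.inr (Sum.inr (Sum.inr (Sum.inl .pt))))).symm

theorem map_sw : map φ (sw o) = sw o' :=
  congrArg (of o')
    (congrFun (congrFun (congrFun h _) _) (Sum.inr (Sum.inr (Sum.inr (Sum.inr .pt))))).symm

theorem map_idn (n : ℕ) : map φ (idn o n) = idn o' n := by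
  induction n with
  | zero => exact map_unit φ h
  | succ n ih => rw [idn, map_mul φ h, ih, map_one φ h]; rfl

theorem map_sigR (n : ℕ) : map φ (sigR o n) = sigR o' n := by
  induction n with
  | zero => exact map_one φ h
  | succ n ih =>
    rw [sigR, map_cmp φ h _ _ (by simp), map_mul φ h, map_mul φ h, ih, map_idn φ h, map_sw φ h,
      map_one φ h]
    rfl

/-- Preserving the basic crossing suffices to preserve all symmetries; this is why maps of algebras
are prop morphisms. -/
theorem map_braid (n m : ℕ) : map φ (braid o n m) = braid o' n m := by
  induction m with
  | zero => exact map_idn φ h n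
  | succ m ih =>
    rw [braid, map_cmp φ h _ _ (by simp; omega), map_mul φ h, map_mul φ h, ih, map_idn φ h,
      map_sigR φ h, map_one φ h]
    rfl

end Op

namespace SMLaws

variable {A : Sig.{u}} {o : SSM.obj A ⟶ A} (H : SMLaws o)

theorem of_toPROP_ident (n : ℕ) : Op.of o (H.toPROP.ident n) = Op.idn o n :=
  LawObj.op_id (LawObj.of H n)

/-- The tensor of objects here is addition by definition, so the conjugating `eqToHom`s are
identities. -/
theorem toPROP_tens {a b c d : ℕ} (f : A a b) (g : A c d) : H.toPROP.tens f g = parOp o f g := by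
  have h : ∀ {X Y : LawObj H} (f : X ⟶ Y), eqToHom rfl ≫ f ≫ eqToHom rfl = f := by simp
  exact h (X := LawObj.of H (a + c)) (Y := LawObj.of H (b + d)) (parOp o f g)

theorem of_toPROP_swap (n m : ℕ) : Op.of o (H.toPROP.swap n m) = Op.braid o n m := by
  have h : ∀ {X Y : LawObj H} (f : X ⟶ Y), eqToHom rfl ≫ f ≫ eqToHom rfl = f := by simp
  exact (congrArg LawObj.op (h (LawObj.swap (LawObj.of H n) (LawObj.of H m)))).trans
    (LawObj.op_swap _ _)

include H in
theorem braid_one_one : Op.braid o 1 1 = Op.sw o := by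
  rw [H.braid_one_left, Op.sigL, Op.sigL, Op.idn, H.unit_tens, H.one_eq, ← H.idn_add]
  exact H.id_comp' _ _ rfl

theorem toPROP_ops : H.toPROP.ops = o :=
  Sig.hom_ext fun n m t => by
    rcases t with ⟨⟨f, g⟩⟩ | ⟨⟨⟩⟩ | ⟨⟨f, g⟩⟩ | ⟨⟨⟩⟩ | ⟨⟨⟩⟩
    · rfl
    · exact Op.of_injective (o := o) ((H.of_toPROP_ident 1).trans H.one_eq.symm)
    · exact H.toPROP_tens f g
    · exact Op.of_injective (o := o) (H.of_toPROP_ident 0)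
    · exact Op.of_injective (o := o) ((H.of_toPROP_swap 1 1).trans H.braid_one_one)

/-- A map which preserves the five operations, as a morphism of props. -/
def toPROPMap {A' : Sig.{u}} {o' : SSM.obj A' ⟶ A'} (H' : SMLaws o') (φ : A ⟶ A')
    (h : SSM.map φ ≫ o' = o ≫ φ) : H.toPROP ⟶ H'.toPROP where
  map := φ
  map_ident n := Op.of_injective (o := o') (((congrArg (Op.map φ) (H.of_toPROP_ident n)).trans
    (Op.map_idn φ h n)).trans (H'.of_toPROP_ident n).symm)
  map_comp f g := Op.map_seqOp φ h f g
  map_tens f g := (congrArg (φ _ _) (H.toPROP_tens f g)).trans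
    ((Op.map_parOp φ h f g).trans (H'.toPROP_tens _ _).symm)
  map_swap n m := Op.of_injective (o := o') (((congrArg (Op.map φ) (H.of_toPROP_swap n m)).trans
    (Op.map_braid φ h n m)).trans (H'.of_toPROP_swap n m).symm)

/-- A prop is the prop of its operations. -/
theorem toPROP_eq (P : PROP.{u}) {o : SSM.obj P.sig ⟶ P.sig} (ho : o = P.ops) (H : SMLaws o) :
    H.toPROP = P := by
  subst ho
  refine PROP.ext_of rfl (heq_of_eq ?_) (heq_of_eq ?_) (heq_of_eq ?_) (heq_of_eq ?_)
  · funext n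
    exact Op.of_injective (A := P.sig) (o := P.ops)
      ((H.of_toPROP_ident n).trans (PROP.op_id (P.of n)).symm)
  · rfl
  · funext a b c d f g
    exact H.toPROP_tens f g
  · funext n m
    exact Op.of_injective (A := P.sig) (o := P.ops)
      ((H.of_toPROP_swap n m).trans (P.op_swap_eq n m).symm)

end SMLaws

theorem SMTerm.map_eval {X A A' : Sig.{u}} {o : SSM.obj A ⟶ A} {o' : SSM.obj A' ⟶ A'}
    (φ : A ⟶ A') (h : SSM.map φ ≫ o' = o ≫ φ) (v : X ⟶ A) {n m : ℕ} (t : SMTerm X n m) :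
    φ n m (t.eval o v) = t.eval o' (v ≫ φ) := by
  have H := fun n m t => congrFun (congrFun (congrFun h n) m) t
  induction t with
  | var x => rfl
  | comp s t hs ht => exact (Op.map_seqOp φ h _ _).trans (congrArg₂ (seqOp o') hs ht)
  | one => exact (H _ _ (Sum.inr (Sum.inl .pt))).symm
  | tens s t hs ht => exact (Op.map_parOp φ h _ _).trans (congrArg₂ (parOp o') hs ht)
  | unit => exact (H _ _ (Sum.inr (Sum.inr (Sum.inr (Sum.inl .pt))))).symm
  | sw => exact (H _ _ (Sum.inr (Sum.inr (Sum.inr (Sum.inr .pt))))).symm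

theorem SMTerm.eval_map {X Y A : Sig.{u}} (o : SSM.obj A ⟶ A) (f : X ⟶ Y) (v : Y ⟶ A) {n m : ℕ}
    (t : SMTerm X n m) : SMTerm.eval o v (SSMFree.map f n m t) = t.eval o (f ≫ v) := by
  induction t with
  | var x => rfl
  | comp s t hs ht => exact congrArg₂ (seqOp o) hs ht
  | one => rfl
  | tens s t hs ht => exact congrArg₂ (parOp o) hs ht
  | unit => rfl
  | sw => rfl

/-! ### The isomorphism between algebras of the prop monad and props -/

namespace SPROP

/-- The algebra of the term monad underlying an algebra of the prop monad. -/
noncomputable def terms (B : SPROP.{u}.Algebra) : SSMFree.{u}.Algebra :=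
  (Monad.algebraFunctorOfMonadHom EqSM.quotientProj).obj B

/-- The five operations of an algebra. -/
noncomputable def algOps (B : SPROP.{u}.Algebra) : SSM.obj B.A ⟶ B.A := SPROP.incl.app B.A ≫ B.a

theorem laws (B : SPROP.{u}.Algebra) : SMLaws (algOps B) :=
  (sat_EqSM_iff (terms B)).1 (EqSM.sat_restrict B)

theorem proj_a (B : SPROP.{u}.Algebra) :
    EqSM.proj B.A ≫ B.a = fun _ _ t => SMTerm.eval (algOps B) (𝟙 B.A) t :=
  Sig.hom_ext fun _ _ t => SSMFree.a_eq_eval (terms B) t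

theorem algOps_natural {B C : SPROP.{u}.Algebra} (f : B ⟶ C) :
    SSM.map f.f ≫ algOps C = algOps B ≫ f.f :=
  ((restrictOps SPROP.incl).map f).h

/-- The prop of an algebra. -/
noncomputable def toPROP : SPROP.{u}.Algebra ⥤ PROP.{u} where
  obj B := (laws B).toPROP
  map {B C} f := (laws B).toPROPMap (laws C) f.f (algOps_natural f)

/-- The algebra of a prop. -/
noncomputable def ofPROP : PROP.{u} ⥤ SPROP.{u}.Algebra where
  obj P := EqSM.liftAlg (SSMFree.mkAlg P.ops)
    ((sat_EqSM_iff _).2 ((SSMFree.algOps_mkAlg P.ops).symm ▸ P.laws))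
  map {P Q} F :=
    { f := F.map
      h := EqSM.proj_cancel (Sig.hom_ext fun n m t => by
        refine (SMTerm.eval_map Q.ops (X := P.sig) (Y := Q.sig) F.map (𝟙 Q.sig) t).trans ?_
        exact (SMTerm.map_eval (A := P.sig) (A' := Q.sig) F.map (PROP.ops_natural F)
          (𝟙 P.sig) t).symm) }

theorem algOps_ofPROP (P : PROP.{u}) : algOps (ofPROP.obj P) = P.ops :=
  SSMFree.algOps_mkAlg P.ops

theorem ofPROP_toPROP_a (B : SPROP.{u}.Algebra) : (ofPROP.obj (toPROP.obj B)).a = B.a := by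
  apply EqSM.proj_cancel
  refine Eq.trans ?_ (proj_a B).symm
  exact congrArg (fun o => (fun _ _ t => SMTerm.eval o (𝟙 B.A) t : SSMFree.obj B.A ⟶ B.A))
    (laws B).toPROP_ops

/-- Underlying signatures and maps never change, so agreement after forgetting is definitional and
only structure maps need comparison. -/
theorem toPROP_ofPROP : toPROP.{u} ⋙ ofPROP = 𝟭 _ :=
  functor_eq_of_faithful (Monad.forget SPROP)
    (fun B => algebra_ext rfl (heq_of_eq (ofPROP_toPROP_a B))) rfl

end SPROP

instance : (PROP.toOps.{u} ⋙ Endofunctor.Algebra.forget SSM).Faithful where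
  map_injective h := PROP.Mor.ext h

theorem SPROP.ofPROP_toPROP : SPROP.ofPROP.{u} ⋙ SPROP.toPROP = 𝟭 _ :=
  functor_eq_of_faithful (PROP.toOps ⋙ Endofunctor.Algebra.forget SSM)
    (fun P => SMLaws.toPROP_eq P (SPROP.algOps_ofPROP P) _) rfl

theorem algebra_mk_ext {F : Sig.{u} ⥤ Sig.{u}} {A : Sig.{u}} {s t : F.obj A ⟶ A} (h : s = t) :
    (⟨A, s⟩ : Endofunctor.Algebra F) = ⟨A, t⟩ := by
  rw [h]

theorem SPROP.toPROP_toOps : SPROP.toPROP.{u} ⋙ PROP.toOps = restrictOps SPROP.incl :=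
  functor_eq_of_faithful (Endofunctor.Algebra.forget SSM)
    (fun B => algebra_mk_ext (SPROP.laws B).toPROP_ops) rfl

/-! ### Carboni–Walters props -/

theorem addConst.mkAlg_natural {T : Monad Sig.{u}} {K : Sig.{u}} {B C : T.Algebra} (f : B ⟶ C)
    {k : K ⟶ B.A} {k' : K ⟶ C.A} (h : k ≫ f.f = k') :
    (addConst T K).map f.f ≫ (addConst.mkAlg C k').a = (addConst.mkAlg B k).a ≫ f.f := by
  subst h
  change T.map (Sig.desc (f.f ≫ Sig.inl) Sig.inr) ≫ T.map (Sig.desc (𝟙 _) (k ≫ f.f)) ≫ C.a =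
    (T.map (Sig.desc (𝟙 _) k) ≫ B.a) ≫ f.f
  have e : Sig.desc (f.f ≫ Sig.inl) Sig.inr ≫ Sig.desc (𝟙 C.A) (k ≫ f.f) =
    Sig.desc (𝟙 B.A) k ≫ f.f := Sig.sum_ext rfl rfl
  rw [← T.map_comp_assoc, e, T.map_comp_assoc, f.h, Category.assoc]

namespace SFR

/-- The underlying algebra of the prop monad. -/
noncomputable def base (D : SFR.{u}.Algebra) : SPROP.{u}.Algebra :=
  (Monad.algebraFunctorOfMonadHom (addConst.inl SPROP Frob)).obj D

/-- The interpretation of the Frobenius operations. -/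
noncomputable def frob (D : SFR.{u}.Algebra) : Frob ⟶ D.A :=
  (addConst.inr SPROP Frob).app D.A ≫ D.a

/-- A closed term lives entirely in the constant summand. After factoring the structure map by
`alg_factor`, the constants are replaced by their interpretations and `proj_a` evaluates the term.
-/
theorem closed_a (D : SFR.{u}.Algebra) {L : Sig.{u}}
    (t : ∀ n m : ℕ, L n m → SMTerm Frob.{u} n m) :
    (SFR.closed t).app D.A ≫ D.a =
      fun n m x => (t n m x).eval (SPROP.algOps (base D)) (frob D) := by
  have h1 : SPROP.map (Sig.desc (𝟙 D.A) (frob D)) ≫ (base D).a = D.a :=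
    addConst.alg_factor SPROP Frob D
  have h2 : SPROP.map (Sig.inr : Frob ⟶ Sig.sum D.A Frob) ≫
      SPROP.map (Sig.desc (𝟙 D.A) (frob D)) = SPROP.map (frob D) :=
    (SPROP.map_comp _ _).symm
  refine (congrArg (fun b => (SFR.closed t).app D.A ≫ b) h1).symm.trans ?_
  refine (congrArg (fun b => (t : L ⟶ SSMFree.obj Frob) ≫ EqSM.quotientProj.app Frob ≫
    b ≫ (base D).a) h2).trans ?_
  refine (congrArg (fun b => (t : L ⟶ SSMFree.obj Frob) ≫ SSMFree.map (frob D) ≫ b)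
    (SPROP.proj_a (base D))).trans ?_
  refine Sig.hom_ext fun n m x => ?_
  exact SMTerm.eval_map (SPROP.algOps (base D)) (frob D) (𝟙 (base D).A) (t n m x)

theorem sat_EqCW_iff (D : SFR.{u}.Algebra) : EqCW.Sat D ↔ ∀ n m (x : FrobLaw n m),
    (FrobLaw.lhs n m x).eval (SPROP.algOps (base D)) (frob D) =
      (FrobLaw.rhs n m x).eval (SPROP.algOps (base D)) (frob D) := by
  constructor
  · intro h n m x
    exact congrFun (congrFun (congrFun
      ((closed_a D FrobLaw.lhs).symm.trans (h.trans (closed_a D FrobLaw.rhs))) n) m) x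
  · intro h
    exact (closed_a D FrobLaw.lhs).trans ((Sig.hom_ext h).trans (closed_a D FrobLaw.rhs).symm)

end SFR

/-- The Carboni–Walters prop of a prop and an interpretation of the Frobenius operations which
satisfies the equations. -/
def CWP.ofLaws (P : PROP.{u}) (k : Frob ⟶ P.sig) (h : ∀ n m (x : FrobLaw.{u} n m),
    (FrobLaw.lhs n m x).eval P.ops k = (FrobLaw.rhs n m x).eval P.ops k) : CWP.{u} where
  P := P
  cm := k 1 2 (Sum.inl .pt)
  cu := k 1 0 (Sum.inr (Sum.inl .pt))
  ml := k 2 1 (Sum.inr (Sum.inr (Sum.inl .pt)))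
  un := k 0 1 (Sum.inr (Sum.inr (Sum.inr .pt)))
  coassoc := h _ _ .coassoc
  cocomm := h _ _ .cocomm
  counit := h _ _ .counit
  assoc := h _ _ .assoc
  comm := h _ _ .comm
  unit := h _ _ .unit
  special := h _ _ .special
  frobLeft := h _ _ .frobLeft
  frobRight := h _ _ .frobRight

theorem CWP.laws (C : CWP.{u}) (n m : ℕ) (x : FrobLaw.{u} n m) :
    (FrobLaw.lhs n m x).eval C.P.ops C.frob = (FrobLaw.rhs n m x).eval C.P.ops C.frob := by
  cases x
  · exact C.coassoc
  · exact C.cocomm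
  · exact C.counit
  · exact C.assoc
  · exact C.comm
  · exact C.unit
  · exact C.special
  · exact C.frobLeft
  · exact C.frobRight

theorem CWP.ofLaws_frob (P : PROP.{u}) (k : Frob ⟶ P.sig) (h) : (CWP.ofLaws P k h).frob = k :=
  Sig.hom_ext fun n m x => by
    rcases x with ⟨⟨⟩⟩ | ⟨⟨⟩⟩ | ⟨⟨⟩⟩ | ⟨⟨⟩⟩ <;> rfl

/-- Heterogeneous equality is needed because the type of `k` depends on a prop that only
propositionally equals `C.P`. -/
theorem CWP.ofLaws_eq (C : CWP.{u}) {P : PROP.{u}} (hP : P = C.P) {k : Frob ⟶ P.sig}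
    (hk : HEq k C.frob) (h) : CWP.ofLaws P k h = C := by
  subst hP
  cases hk
  rfl

/-- A morphism of props which preserves the Frobenius operations. -/
def CWP.ofLawsMap {P Q : PROP.{u}} {k : Frob ⟶ P.sig} {k' : Frob ⟶ Q.sig} (h h')
    (F : P ⟶ Q) (hk : k ≫ (F.map : P.sig ⟶ Q.sig) = k') :
    CWP.ofLaws P k h ⟶ CWP.ofLaws Q k' h' where
  F := F
  map_cm := congrFun (congrFun (congrFun hk _) _) _
  map_cu := congrFun (congrFun (congrFun hk _) _) _
  map_ml := congrFun (congrFun (congrFun hk _) _) _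
  map_un := congrFun (congrFun (congrFun hk _) _) _

theorem CWP.frob_natural {C D : CWP.{u}} (f : C ⟶ D) :
    C.frob ≫ (f.F.map : C.P.sig ⟶ D.P.sig) = D.frob :=
  (congrArg (fun t => Sig.inr ≫ t) (CWP.toOps.map f).h).symm

namespace SCW

/-- The underlying algebra of the monad without equations. -/
noncomputable def base (B : SCW.{u}.Algebra) : SFR.{u}.Algebra :=
  (Monad.algebraFunctorOfMonadHom EqCW.quotientProj).obj B

/-- The underlying algebra of the prop monad, functorially. -/
noncomputable def toSPROP : SCW.{u}.Algebra ⥤ SPROP.{u}.Algebra :=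
  Monad.algebraFunctorOfMonadHom EqCW.quotientProj ⋙
    Monad.algebraFunctorOfMonadHom (addConst.inl SPROP Frob)

theorem laws (B : SCW.{u}.Algebra) (n m : ℕ) (x : FrobLaw.{u} n m) :
    (FrobLaw.lhs n m x).eval (SPROP.toPROP.obj (toSPROP.obj B)).ops (SFR.frob (base B)) =
      (FrobLaw.rhs n m x).eval (SPROP.toPROP.obj (toSPROP.obj B)).ops (SFR.frob (base B)) := by
  have h := (SFR.sat_EqCW_iff (base B)).1 (EqCW.sat_restrict B) n m x
  have e : (SPROP.toPROP.obj (toSPROP.obj B)).ops = SPROP.algOps (SFR.base (base B)) :=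
    (SPROP.laws _).toPROP_ops
  rw [e]
  exact h

theorem frob_natural {B C : SCW.{u}.Algebra} (f : B ⟶ C) :
    SFR.frob (base B) ≫ f.f = SFR.frob (base C) := by
  have h := ((restrictOps (addConst.inr SPROP Frob)).map
    ((Monad.algebraFunctorOfMonadHom EqCW.quotientProj).map f)).h
  exact h.symm

/-- The Carboni–Walters prop of an algebra. -/
noncomputable def toCWP : SCW.{u}.Algebra ⥤ CWP.{u} where
  obj B := CWP.ofLaws (SPROP.toPROP.obj (toSPROP.obj B)) (SFR.frob (base B)) (laws B)
  map {B C} f := CWP.ofLawsMap (laws B) (laws C) (SPROP.toPROP.map (toSPROP.map f))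
    (frob_natural f)

/-- Both the interpreted constants and the underlying prop operations of `mkAlg` are those it was
built from, so the laws of `C` apply. -/
theorem sat_mkAlg (C : CWP.{u}) :
    EqCW.Sat (addConst.mkAlg (SPROP.ofPROP.obj C.P) C.frob : SFR.{u}.Algebra) := by
  refine (SFR.sat_EqCW_iff _).2 ?_
  have h1 : SFR.frob (addConst.mkAlg (SPROP.ofPROP.obj C.P) C.frob) = C.frob :=
    addConst.inr_mkAlg _ _
  have h2 : SPROP.algOps (SFR.base (addConst.mkAlg (SPROP.ofPROP.obj C.P) C.frob)) = C.P.ops :=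
    (congrArg (fun t => SPROP.incl.app C.P.sig ≫ t) (addConst.restrict_mkAlg_a _ _)).trans
      (SPROP.algOps_ofPROP C.P)
  intro n m x
  rw [h1, h2]
  exact C.laws n m x

/-- The algebra of a Carboni–Walters prop. -/
noncomputable def ofCWP : CWP.{u} ⥤ SCW.{u}.Algebra where
  obj C := EqCW.liftAlg (addConst.mkAlg (SPROP.ofPROP.obj C.P) C.frob) (sat_mkAlg C)
  map {C D} f :=
    { f := f.F.map
      h := EqCW.proj_cancel
        (addConst.mkAlg_natural (SPROP.ofPROP.map f.F) (CWP.frob_natural f)) }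

/-- By `alg_factor` the structure map is rebuilt from the prop algebra and the Frobenius operations,
and both survive the round trip. -/
theorem ofCWP_toCWP_a (B : SCW.{u}.Algebra) : (ofCWP.obj (toCWP.obj B)).a = B.a := by
  apply EqCW.proj_cancel
  refine Eq.trans ?_ (addConst.alg_factor SPROP Frob (base B))
  have h1 : (toCWP.obj B).frob = SFR.frob (base B) := CWP.ofLaws_frob _ _ (laws B)
  have h2 : (SPROP.ofPROP.obj (SPROP.toPROP.obj (toSPROP.obj B))).a = (toSPROP.obj B).a :=
    SPROP.ofPROP_toPROP_a _
  exact congrArg₂ (fun k a => SPROP.map (Sig.desc (𝟙 B.A) k) ≫ a) h1 h2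

theorem toCWP_ofCWP : toCWP.{u} ⋙ ofCWP = 𝟭 _ :=
  functor_eq_of_faithful (Monad.forget SCW)
    (fun B => algebra_ext rfl (heq_of_eq (ofCWP_toCWP_a B))) rfl

end SCW

instance : (CWP.toOps.{u} ⋙ Endofunctor.Algebra.forget SSMFrob).Faithful where
  map_injective h := CWP.Mor.ext (PROP.Mor.ext h)

theorem SCW.toPROP_toSPROP_ofCWP (C : CWP.{u}) :
    SPROP.toPROP.obj (SCW.toSPROP.obj (SCW.ofCWP.obj C)) = C.P := by
  refine SMLaws.toPROP_eq C.P ?_ _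
  exact (congrArg (fun t => SPROP.incl.app C.P.sig ≫ t) (addConst.restrict_mkAlg_a _ _)).trans
    (SPROP.algOps_ofPROP C.P)

theorem SCW.ofCWP_toCWP : SCW.ofCWP.{u} ⋙ SCW.toCWP = 𝟭 _ :=
  functor_eq_of_faithful (CWP.toOps ⋙ Endofunctor.Algebra.forget SSMFrob)
    (fun C => CWP.ofLaws_eq C (SCW.toPROP_toSPROP_ofCWP C)
      (heq_of_eq (addConst.inr_mkAlg (SPROP.ofPROP.obj C.P) C.frob))
      (SCW.laws (SCW.ofCWP.obj C))) rfl

theorem SCW.toCWP_toOps : SCW.toCWP.{u} ⋙ CWP.toOps = restrictOps SCW.incl :=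
  functor_eq_of_faithful (Endofunctor.Algebra.forget SSMFrob)
    (fun B => algebra_mk_ext (Sig.sum_ext (SPROP.laws _).toPROP_ops
      (CWP.ofLaws_frob (SPROP.toPROP.obj (SCW.toSPROP.obj B)) (SFR.frob (SCW.base B))
        (SCW.laws B)))) rfl

end StringDiag

/-! ### Assembly of the claim -/

theorem mainTheorem2 :
    -- signatures as spans and as families indexed by pairs of natural numbers
    StringDiag.fibres.{u}.IsEquivalence ∧
    -- the term monad is the free monad on the signature functor of the prop operations
    StringDiag.IsFreeMonad.{u} StringDiag.SSM StringDiag.SSMFree StringDiag.SSMFree.op ∧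
    -- the prop monad is its quotient by the equations of symmetric monoidal categories
    StringDiag.IsQuotientMonad.{u} StringDiag.EqSM StringDiag.SPROP
      StringDiag.EqSM.quotientProj ∧
    -- the Eilenberg–Moore category of the prop monad is isomorphic to the category of props,
    -- compatibly with the prop operations
    (∃ (Φ : StringDiag.SPROP.{u}.Algebra ⥤ StringDiag.PROP.{u})
        (Ψ : StringDiag.PROP.{u} ⥤ StringDiag.SPROP.{u}.Algebra),
      Φ ⋙ Ψ = 𝟭 StringDiag.SPROP.{u}.Algebra ∧ Ψ ⋙ Φ = 𝟭 StringDiag.PROP.{u} ∧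
      Φ ⋙ StringDiag.PROP.toOps = StringDiag.restrictOps StringDiag.SPROP.incl) ∧
    -- the extension of the prop monad by the Frobenius operations is a coproduct of monads
    StringDiag.IsCoproductConst.{u} (S := StringDiag.SFR)
      (StringDiag.addConst.inl StringDiag.SPROP StringDiag.Frob)
      (StringDiag.addConst.inr StringDiag.SPROP StringDiag.Frob) ∧
    -- the Carboni–Walters monad is its quotient by the special Frobenius equations
    StringDiag.IsQuotientMonad.{u} StringDiag.EqCW StringDiag.SCW
      StringDiag.EqCW.quotientProj ∧
    -- the Eilenberg–Moore category of the Carboni–Walters monad is isomorphic to the category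
    -- of Carboni–Walters props, compatibly with the operations
    (∃ (Φ : StringDiag.SCW.{u}.Algebra ⥤ StringDiag.CWP.{u})
        (Ψ : StringDiag.CWP.{u} ⥤ StringDiag.SCW.{u}.Algebra),
      Φ ⋙ Ψ = 𝟭 StringDiag.SCW.{u}.Algebra ∧ Ψ ⋙ Φ = 𝟭 StringDiag.CWP.{u} ∧
      Φ ⋙ StringDiag.CWP.toOps = StringDiag.restrictOps StringDiag.SCW.incl) :=
  ⟨StringDiag.fibres_isEquivalence, StringDiag.isFreeMonad_SSMFree,
    StringDiag.EqSM.isQuotientMonad_quotient,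
    ⟨StringDiag.SPROP.toPROP, StringDiag.SPROP.ofPROP, StringDiag.SPROP.toPROP_ofPROP,
      StringDiag.SPROP.ofPROP_toPROP, StringDiag.SPROP.toPROP_toOps⟩,
    StringDiag.addConst.isCoproductConst StringDiag.SPROP StringDiag.Frob,
    StringDiag.EqCW.isQuotientMonad_quotient,
    StringDiag.SCW.toCWP, StringDiag.SCW.ofCWP, StringDiag.SCW.toCWP_ofCWP,
    StringDiag.SCW.ofCWP_toCWP, StringDiag.SCW.toCWP_toOps⟩
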